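/- A \emph{pathograph} $\mathfrak{H}=(V,U,E,S,R,\pi)$ consists of a finite set $V$ of vertices, a finite set $U$ of urpaths, a set $E\subseteq\binom{V}{2}$ of edges, a set $S\subseteq V\times U$ of spokes, a set $R\subseteq\binom{U}{2}$ of rungs, and a map $\pi:U\to\binom{V}{2}$ giving the endpoints of each urpath, where $\pi(u)\notin E$ for all $u\in U$. A \emph{realization} of $\mathfrak{H}$ is a graph $G$ obtained by keeping the vertices $V$, with exactly the edges $E$ between them, and replacing each urpath $u$, say with $\pi(u)=\{a,b\}$, by an induced path $P_u=a\,x_u^{(1)}\cdots x_u^{(m_u)}\,b$ with $m_u\ge 1$ new internal vertices, such that: for every $u\in U$ and $v\in V\setminus\pi(u)$, $v$ is adjacent to some internal vertex of $P_u$ if and only if $(v,u)\in S$; and for all distinct $u,u'\in U$, some internal vertex of $P_u$ is adjacent to some internal vertex of $P_{u'}$ if and only if $\{u,u'\}\in R$. A graph $G$ is \emph{$\mathcal{F}$-free}, for a set $\mathcal{F}$ of pathographs, if no induced subgraph of $G$ is isomorphic to a realization of a member of $\mathcal{F}$. Theorem. Let $\mathfrak{H}$ be a fixed pathograph with no rungs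 and let $\mathcal{F}$ be a fixed finite set of pathographs. Then there is a linear-time algorithm that decides whether a given realization $G$ of $\mathfrak{H}$ is $\mathcal{F}$-free, where $G$ is given with vertex labels compatible with $\mathfrak{H}$, that is, labels that tell which vertices of $G$ are the vertices of $\mathfrak{H}$ and which vertex of $\mathfrak{H}$ each of them is. Precisely: there are a program for a random access machine whose only arithmetic operations are adding and subtracting $1$, and a constant $c$, both depending only on $\mathfrak{H}$ (with a numbering of its vertices) and $\mathcal{F}$, such that on every such $G$, presented by its vertex labels and a list of its edges in arbitrary order, the program halts after at most $c\,(|V(G)|+|E(G)|+1)$ steps and outputs $1$ if $G$ is $\mathcal{F}$-free and $0$ otherwise. -/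

import Mathlib

universe u v w

/-- A pathograph `(V, U, E, S, R, π)` with finitely many vertices and urpaths. -/
structure Pathograph where
  /-- the vertices -/
  V : Type u
  /-- the urpaths -/
  U : Type u
  finite_V : Finite V
  finite_U : Finite U
  /-- the edges: a set of unordered pairs of distinct vertices -/
  E : SimpleGraph V
  /-- the spokes -/
  S : Set (V × U)
  /-- the rungs: a set of unordered pairs of distinct urpaths -/
  R : SimpleGraph U
  /-- the endpoints of an urpath -/
  ends : U → Sym2 V
  /-- the two endpoints of an urpath are distinct ... -/
  ends_ne : ∀ p, ¬ (ends p).IsDiag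
  /-- ... and nonadjacent -/
  ends_nonadj : ∀ p, ends p ∉ E.edgeSet

namespace Pathograph

/-- A way in which the graph `G` is a realization of the pathograph `H`: the vertices of `H` are
kept, with the edges between them, and each urpath `p` is replaced by an induced path
`vert (left p), inner p 0, …, inner p (len p - 1), vert (right p)`. -/
structure Realization {W : Type w} (H : Pathograph.{u}) (G : SimpleGraph W) where
  /-- the vertex of `G` that a vertex of `H` becomes -/
  vert : H.V → W
  /-- the endpoint of the urpath at which the path is started -/
  left : H.U → H.V
  /-- the endpoint of the urpath at which the path finishes -/
  right : H.U → H.V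
  ends_eq : ∀ p, H.ends p = s(left p, right p)
  /-- the number of internal vertices of the path -/
  len : H.U → ℕ
  one_le_len : ∀ p, 1 ≤ len p
  /-- the internal vertices of the path, in order -/
  inner : ∀ p, Fin (len p) → W
  /-- the vertices of `G` are exactly the vertices of `H` and the internal vertices of the paths,
  without repetition -/
  bijective : Function.Bijective
    (Sum.elim vert (fun q : (Σ p, Fin (len p)) => inner q.1 q.2) : H.V ⊕ (Σ p, Fin (len p)) → W)
  adj_vert : ∀ a b, G.Adj (vert a) (vert b) ↔ H.E.Adj a b
  /-- the three facts that say that the path is induced; its two endpoints are nonadjacent because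
  they are nonadjacent in `H` -/
  adj_inner : ∀ p (i j : Fin (len p)),
    G.Adj (inner p i) (inner p j) ↔ (i.val + 1 = j.val ∨ j.val + 1 = i.val)
  adj_left : ∀ p (i : Fin (len p)), G.Adj (vert (left p)) (inner p i) ↔ i.val = 0
  adj_right : ∀ p (i : Fin (len p)), G.Adj (vert (right p)) (inner p i) ↔ i.val + 1 = len p
  /-- spokes; the adjacencies of an endpoint of `p` to the path are those of the path itself -/
  adj_spoke : ∀ a p, a ∉ H.ends p → ((a, p) ∈ H.S ↔ ∃ i, G.Adj (vert a) (inner p i))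
  /-- rungs -/
  adj_rung : ∀ p q, p ≠ q → (H.R.Adj p q ↔ ∃ i j, G.Adj (inner p i) (inner q j))

/-- `H` has no rungs. -/
def Rungless (H : Pathograph.{u}) : Prop := ∀ p q, ¬ H.R.Adj p q

/-- The graph `G` contains `F`: some induced subgraph of `G` is a realization of `F`. -/
def ContainedIn {W : Type w} (F : Pathograph.{u}) (G : SimpleGraph W) : Prop :=
  ∃ s : Set W, Nonempty (F.Realization (G.induce s))

/-- `G` contains no member of `𝓕`. -/
def IsFree {W : Type w} (𝓕 : Set Pathograph.{u}) (G : SimpleGraph W) : Prop :=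
  ∀ F ∈ 𝓕, ¬ F.ContainedIn G

end Pathograph

/-! A random access machine, programmed in a structured language. A program uses finitely many
registers and finitely many arrays, whose cells hold natural numbers; an array cell is reached in
one step through an index held in a register. The only arithmetic is adding or subtracting one, so
that a run of `t` steps handles no number above the largest one in the input and the program, plus
`t`: in a linear-time run all numbers have logarithmically many bits. -/

namespace RAM

/-- The contents of the registers and of the arrays. -/
structure State where
  reg : ℕ → ℕ
  arr : ℕ → ℕ → ℕ

/-- Write `x` into register `r`. -/
def State.setReg (σ : State) (r x : ℕ) : State :=
  { σ with reg := Function.update σ.reg r x }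

/-- Write `x` into cell `i` of array `a`. -/
def State.setArr (σ : State) (a i x : ℕ) : State :=
  { σ with arr := Function.update σ.arr a (Function.update (σ.arr a) i x) }

/-- Comparisons of two registers. -/
inductive Test
  | eq (r s : ℕ)
  | lt (r s : ℕ)

/-- The truth value of a comparison. -/
def Test.Holds (σ : State) : Test → Prop
  | .eq r s => σ.reg r = σ.reg s
  | .lt r s => σ.reg r < σ.reg s

/-- Programs. Each register, array and constant that occurs in one is fixed. -/
inductive Program
  | skip
  /-- `r := c` -/
  | const (r c : ℕ)
  /-- `r := s` -/
  | copy (r s : ℕ)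
  /-- `r := r + 1` -/
  | succ (r : ℕ)
  /-- `r := r - 1`, where `0 - 1 = 0` -/
  | pred (r : ℕ)
  /-- `r := a[i]`, with the index in register `i` -/
  | load (r a i : ℕ)
  /-- `a[i] := r`, with the index in register `i` -/
  | store (a i r : ℕ)
  | seq (P Q : Program)
  /-- if the test holds then `P` else `Q` -/
  | cond (b : Test) (P Q : Program)
  /-- while the test holds do `P` -/
  | loop (b : Test) (P : Program)

/-- `Runs P σ t τ`: started in `σ`, the program `P` halts in `τ` after `t` steps. Every
instruction and every evaluation of a test is one step. -/
inductive Runs : Program → State → ℕ → State → Prop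
  | skip (σ) : Runs .skip σ 1 σ
  | const (σ r c) : Runs (.const r c) σ 1 (σ.setReg r c)
  | copy (σ r s) : Runs (.copy r s) σ 1 (σ.setReg r (σ.reg s))
  | succ (σ r) : Runs (.succ r) σ 1 (σ.setReg r (σ.reg r + 1))
  | pred (σ r) : Runs (.pred r) σ 1 (σ.setReg r (σ.reg r - 1))
  | load (σ r a i) : Runs (.load r a i) σ 1 (σ.setReg r (σ.arr a (σ.reg i)))
  | store (σ a i r) : Runs (.store a i r) σ 1 (σ.setArr a (σ.reg i) (σ.reg r))
  | seq {P Q σ τ υ t t'} : Runs P σ t τ → Runs Q τ t' υ → Runs (.seq P Q) σ (t + t') υ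
  | cond_true {b P Q σ τ t} : b.Holds σ → Runs P σ t τ → Runs (.cond b P Q) σ (1 + t) τ
  | cond_false {b P Q σ τ t} : ¬ b.Holds σ → Runs Q σ t τ → Runs (.cond b P Q) σ (1 + t) τ
  | loop_true {b P σ τ υ t t'} : b.Holds σ → Runs P σ t τ → Runs (.loop b P) τ t' υ →
      Runs (.loop b P) σ (1 + t + t') υ
  | loop_false {b P σ} : ¬ b.Holds σ → Runs (.loop b P) σ 1 σ

/-- Runs are deterministic: the number of steps and the final state are unique. -/
theorem Runs.unique {P : Program} {σ τ τ' : State} {t t' : ℕ} (h : Runs P σ t τ)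
    (h' : Runs P σ t' τ') : t = t' ∧ τ = τ' := by
  induction h generalizing t' τ' with
  | seq _ _ ih₁ ih₂ =>
    cases h' with
    | seq a b =>
      obtain ⟨rfl, rfl⟩ := ih₁ a
      obtain ⟨rfl, rfl⟩ := ih₂ b
      exact ⟨rfl, rfl⟩
  | cond_true hb _ ih =>
    cases h' with
    | cond_true _ a => obtain ⟨rfl, rfl⟩ := ih a; exact ⟨rfl, rfl⟩
    | cond_false hn _ => exact absurd hb hn
  | cond_false hb _ ih =>
    cases h' with
    | cond_true hn _ => exact absurd hn hb
    | cond_false _ a => obtain ⟨rfl, rfl⟩ := ih a; exact ⟨rfl, rfl⟩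
  | loop_true hb _ _ ih₁ ih₂ =>
    cases h' with
    | loop_true _ a b =>
      obtain ⟨rfl, rfl⟩ := ih₁ a
      obtain ⟨rfl, rfl⟩ := ih₂ b
      exact ⟨rfl, rfl⟩
    | loop_false hn => exact absurd hb hn
  | loop_false hb =>
    cases h' with
    | loop_true hn _ _ => exact absurd hn hb
    | loop_false _ => exact ⟨rfl, rfl⟩
  | _ => cases h'; exact ⟨rfl, rfl⟩

end RAM

/-- A graph with vertices `0, …, n - 1`, each carrying a number as its label, presented by the list
of its edges: every edge occurs once, in one of its two orientations, and the order is arbitrary. -/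
structure LabelledEdgeList where
  n : ℕ
  label : Fin n → ℕ
  edges : List (Fin n × Fin n)
  loopless : ∀ e ∈ edges, e.1 ≠ e.2
  nodup : (edges.map (fun e => s(e.1, e.2))).Nodup

namespace LabelledEdgeList

/-- The number of edges. -/
def m (I : LabelledEdgeList) : ℕ := I.edges.length

/-- The presented graph. -/
def graph (I : LabelledEdgeList) : SimpleGraph (Fin I.n) where
  Adj x y := (x, y) ∈ I.edges ∨ (y, x) ∈ I.edges
  symm := ⟨fun _ _ h => h.symm⟩
  loopless := ⟨fun _ h => h.elim (fun h => I.loopless _ h rfl) (fun h => I.loopless _ h rfl)⟩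

/-- The state in which a machine is started on the input `I`: registers `0` and `1` hold the numbers
of vertices and of edges, array `0` holds the labels, arrays `1` and `2` hold the first and the second
ends of the edges, and everything else is zero. -/
def init (I : LabelledEdgeList) : RAM.State where
  reg r := match r with
    | 0 => I.n
    | 1 => I.m
    | _ => 0
  arr a i := match a with
    | 0 => if h : i < I.n then I.label ⟨i, h⟩ else 0
    | 1 => if h : i < I.m then (I.edges[i]'h).1 else 0
    | 2 => if h : i < I.m then (I.edges[i]'h).2 else 0
    | _ => 0

/-- The labels of `I` tell which vertex of `I.graph` is which vertex of `H`, where the vertices of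
`H` are numbered by `num`: the vertex that `x` becomes has the label `num x + 1`, and the vertices
that are not vertices of `H` have the label `0`. -/
def Compatible (I : LabelledEdgeList) {H : Pathograph.{u}} {k : ℕ} (num : H.V ≃ Fin k)
    (ρ : H.Realization I.graph) : Prop :=
  (∀ x, I.label (ρ.vert x) = (num x).val + 1) ∧ ∀ y, y ∉ Set.range ρ.vert → I.label y = 0

end LabelledEdgeList

/-!
A realization `G` of a pathograph without rungs consists of a bounded number of vertices, those of
the pathograph, and of disjoint paths with no edges between them. Listing the vertices of the paths
one path after the other turns `G` into a word over a finite alphabet: the letter of a vertex tells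
which vertices of the pathograph it is adjacent to, and whether it is adjacent to the vertex next to
it in the list (`IsLayout`). Being `𝓕`-free is recognized by a finite automaton on these words
(`Definable.isFree`), and a random access machine can compute such a list and run the automaton
along it in linear time (`LabelledEdgeList.exists_runs_decider`).

The automaton comes from the closure properties of regular languages that express monadic
second-order logic: the properties of coloured graphs that are recognized by an automaton
(`Definable`) include "some vertex has a colour in `P`" and "some edge has colours related by `T`",
and they are closed under Boolean operations and under quantification over colourings, which is the
powerset construction. Containment of a pathograph `F` is the existence of a colouring of vertices
of `G` by the vertices and the urpaths of `F` (`Pathograph.containedIn_iff_exists_isColoring`). The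
only condition on it that is not visibly of the above kind is that the vertices of an urpath and its
endpoints `a` and `b` form an induced path from `a` to `b`. This holds if and only if they form an
inclusion-minimal set linking `a` to `b` (`MinLinks.exists_path`, `minLinks_of_path`), and that a
set links `a` to `b` is expressed by quantifying over the partitions of the set.

The program reads the edges once, and records for each vertex on the paths its at most two
neighbours on the paths and the set of its neighbours in the pathograph, as a binary number. It then
looks for vertices with at most one neighbour on the paths; each one that has not been traversed yet
is an end of a path, which the program follows to the other end. That this produces a correct list
needs only that degrees on the paths are at most two (`OpenTrail.cons`), and that it reaches all
vertices needs only that no component is a cycle (`LabelledEdgeList.NoCycle`).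
-/

/-! ### Layouts and automata -/

/-- Along the list `L`, every vertex is adjacent to no later vertex except possibly the next one. -/
def IsLinear {W : Type*} (G : SimpleGraph W) : List W → Prop
  | [] => True
  | x :: L => IsLinear G L ∧ ∀ y ∈ L, G.Adj x y → y ∈ L.head?

/-- The graph `G` consists of a copy of the fixed graph `E`, embedded by `base`, and of the vertices
in the list `L`, among which only consecutive ones may be adjacent. The adjacencies between the two
parts are arbitrary. -/
structure IsLayout {k : ℕ} (E : SimpleGraph (Fin k)) {W : Type*} (G : SimpleGraph W)
    (base : Fin k → W) (L : List W) : Prop where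
  inj : Function.Injective base
  nodup : L.Nodup
  disj : ∀ j, base j ∉ L
  cover : ∀ x, x ∈ Set.range base ∨ x ∈ L
  adj_base : ∀ i j, G.Adj (base i) (base j) ↔ E.Adj i j
  linear : IsLinear G L

/-- The run of an automaton along the vertices in `L`, from the last to the first. The letter read
at a vertex `x` tells its neighbours in the base, whether it is adjacent to the vertex read just
before it, and its colour. -/
def scan {k : ℕ} {W C Q : Type*} (G : SimpleGraph W) (base : Fin k → W) (χ : W → C)
    (step : (Fin k → Prop) → Prop → C → Q → Q) (q₀ : Q) : List W → Q
  | [] => q₀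
  | x :: L => step (fun j => G.Adj (base j) x) (∃ y ∈ L.head?, G.Adj x y) (χ x)
      (scan G base χ step q₀ L)

theorem scan_congr {k : ℕ} {W C Q : Type*} {G : SimpleGraph W} {base : Fin k → W} {χ χ' : W → C}
    {step : (Fin k → Prop) → Prop → C → Q → Q} {q₀ : Q} {L : List W}
    (h : ∀ x ∈ L, χ x = χ' x) : scan G base χ step q₀ L = scan G base χ' step q₀ L := by
  induction L with
  | nil => rfl
  | cons x L ih =>
    rw [scan, scan, h x (by simp), ih fun y hy => h y (by simp [hy])]

theorem scan_map {k : ℕ} {W C Q Q' : Type*} {G : SimpleGraph W} {base : Fin k → W} {χ : W → C}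
    {step : (Fin k → Prop) → Prop → C → Q → Q} {step' : (Fin k → Prop) → Prop → C → Q' → Q'}
    {q₀ : Q} {f : Q → Q'} (hf : ∀ μ b c q, f (step μ b c q) = step' μ b c (f q)) {L : List W} :
    scan G base χ step' (f q₀) L = f (scan G base χ step q₀ L) := by
  induction L with
  | nil => rfl
  | cons x L ih => rw [scan, scan, ih, hf]

theorem scan_comap {k : ℕ} {W C D Q : Type*} {G : SimpleGraph W} {base : Fin k → W} {χ : W → D}
    {f : D → C} {step : (Fin k → Prop) → Prop → C → Q → Q} {q₀ : Q} {L : List W} :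
    scan G base χ (fun μ b c => step μ b (f c)) q₀ L = scan G base (f ∘ χ) step q₀ L := by
  induction L with
  | nil => rfl
  | cons x L ih => rw [scan, scan, ih, Function.comp_apply]

/-- The property `Φ` of vertex-coloured graphs is recognized by a finite automaton: on the graphs
laid out over `E`, for any fixed colouring of the base, it is decided by a run along the layout. -/
def Definable {k : ℕ} (E : SimpleGraph (Fin k)) {C : Type*}
    (Φ : ∀ W : Type, SimpleGraph W → (W → C) → Prop) : Prop :=
  ∀ χ₀ : Fin k → C, ∃ (s : ℕ) (step : (Fin k → Prop) → Prop → C → Fin s → Fin s) (q₀ : Fin s)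
    (acc : Set (Fin s)), ∀ (W : Type) (G : SimpleGraph W) (base : Fin k → W) (L : List W)
    (χ : W → C), IsLayout E G base L → (∀ j, χ (base j) = χ₀ j) →
      (Φ W G χ ↔ scan G base χ step q₀ L ∈ acc)

namespace Definable

variable {k : ℕ} {E : SimpleGraph (Fin k)} {C : Type*}
  {Φ Ψ : ∀ W : Type, SimpleGraph W → (W → C) → Prop}

/-- The states of the automaton may form any finite type. -/
theorem of_finite (h : ∀ χ₀ : Fin k → C, ∃ (Q : Type w) (_ : Finite Q)
    (step : (Fin k → Prop) → Prop → C → Q → Q) (q₀ : Q)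
    (acc : Set Q), ∀ (W : Type) (G : SimpleGraph W) (base : Fin k → W) (L : List W)
    (χ : W → C), IsLayout E G base L → (∀ j, χ (base j) = χ₀ j) →
      (Φ W G χ ↔ scan G base χ step q₀ L ∈ acc)) : Definable E Φ := by
  intro χ₀
  obtain ⟨Q, _, step, q₀, acc, h⟩ := h χ₀
  obtain ⟨s, ⟨e⟩⟩ := Finite.exists_equiv_fin Q
  refine ⟨s, fun μ b c q => e (step μ b c (e.symm q)), e q₀, e.symm ⁻¹' acc, ?_⟩
  intro W G base L χ hL hχ
  rw [h W G base L χ hL hχ, scan_map (f := e) (step := step) (by simp)]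
  simp

theorem not (h : Definable E Φ) : Definable E fun W G χ => ¬ Φ W G χ := by
  intro χ₀
  obtain ⟨s, step, q₀, acc, h⟩ := h χ₀
  exact ⟨s, step, q₀, accᶜ, fun W G base L χ hL hχ => not_congr (h W G base L χ hL hχ)⟩

theorem forall_finite {ι : Type*} [Finite ι] {Φ : ι → ∀ W : Type, SimpleGraph W → (W → C) → Prop}
    (h : ∀ i, Definable E (Φ i)) : Definable E fun W G χ => ∀ i, Φ i W G χ := by
  refine of_finite fun χ₀ => ?_
  choose s step q₀ acc h using fun i => h i χ₀
  refine ⟨∀ i, Fin (s i), inferInstance, fun μ b c q i => step i μ b c (q i), q₀,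
    {q | ∀ i, q i ∈ acc i}, fun W G base L χ hL hχ => ?_⟩
  refine forall_congr' fun i => ?_
  rw [h i W G base L χ hL hχ]
  rw [← scan_map (f := fun q : ∀ i, Fin (s i) => q i)]
  exact fun _ _ _ _ => rfl

theorem congr (h : Definable E Φ) (hΦ : ∀ W G χ, Φ W G χ ↔ Ψ W G χ) : Definable E Ψ := by
  rwa [show Ψ = Φ by funext W G χ; exact propext (hΦ W G χ).symm]

theorem comap {D : Type*} {f : D → C} (h : Definable E Φ) :
    Definable E fun W G χ => Φ W G (f ∘ χ) := by
  intro χ₀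
  obtain ⟨s, step, q₀, acc, h⟩ := h (f ∘ χ₀)
  refine ⟨s, fun μ b c => step μ b (f c), q₀, acc, fun W G base L χ hL hχ => ?_⟩
  rw [scan_comap]
  exact h W G base L (f ∘ χ) hL fun j => congrArg f (hχ j)

theorem const (p : Prop) : Definable E fun W _ (_ : W → C) => p :=
  of_finite fun _ => ⟨Unit, inferInstance, fun _ _ _ q => q, (), {_q | p},
    fun _ _ _ _ _ _ _ => Iff.rfl⟩

theorem and (h₁ : Definable E Φ) (h₂ : Definable E Ψ) :
    Definable E fun W G χ => Φ W G χ ∧ Ψ W G χ := by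
  have := forall_finite (E := E) (Φ := fun i : Bool => bif i then Φ else Ψ)
    (by rintro (_ | _) <;> assumption)
  simpa [Bool.forall_bool, and_comm] using this

theorem imp (h₁ : Definable E Φ) (h₂ : Definable E Ψ) :
    Definable E fun W G χ => Φ W G χ → Ψ W G χ := by
  simpa [not_and, not_not] using (h₁.and h₂.not).not

theorem iff (h₁ : Definable E Φ) (h₂ : Definable E Ψ) :
    Definable E fun W G χ => (Φ W G χ ↔ Ψ W G χ) := by
  simpa [iff_iff_implies_and_implies] using (h₁.imp h₂).and (h₂.imp h₁)

theorem exists_finite {ι : Type*} [Finite ι] {Φ : ι → ∀ W : Type, SimpleGraph W → (W → C) → Prop}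
    (h : ∀ i, Definable E (Φ i)) : Definable E fun W G χ => ∃ i, Φ i W G χ := by
  simpa using (forall_finite fun i => (h i).not).not

/-- The powerset construction: the colours that are quantified over are guessed along the run. The
induction hypothesis on `L` needs only colourings that extend a prescribed one on the base. -/
theorem mem_scan_powerset {W D Q : Type*} [Nonempty D] {G : SimpleGraph W} {base : Fin k → W}
    {χ : W → C} {step : (Fin k → Prop) → Prop → C × D → Q → Q} {q₀ : Q} {L : List W}
    (inj : Function.Injective base) (hL : L.Nodup) (disj : ∀ j, base j ∉ L) (ψ₀ : Fin k → D)
    (q : Q) :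
    q ∈ scan G base χ (fun μ b c (S : Set Q) => {q' | ∃ d, ∃ q ∈ S, step μ b (c, d) q = q'})
        {q₀} L ↔
      ∃ ψ : W → D, (∀ j, ψ (base j) = ψ₀ j) ∧ scan G base (fun x => (χ x, ψ x)) step q₀ L = q := by
  classical
  induction L generalizing q with
  | nil =>
    simp only [scan, Set.mem_singleton_iff]
    refine ⟨fun h => ⟨Function.extend base ψ₀ fun _ => Classical.arbitrary D,
      inj.extend_apply _ _, h.symm⟩, fun ⟨_, _, h⟩ => h.symm⟩
  | cons x L ih =>
    rw [List.nodup_cons] at hL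
    have ih := ih hL.2 fun j h => disj j (by simp [h])
    constructor
    · rintro ⟨d, q', hq', rfl⟩
      obtain ⟨ψ, hψ, rfl⟩ := (ih q').1 hq'
      refine ⟨Function.update ψ x d, fun j => ?_, ?_⟩
      · rw [Function.update_of_ne, hψ]
        rintro rfl
        exact disj j (by simp)
      · rw [scan, Function.update_self, scan_congr]
        intro y hy
        rw [Function.update_of_ne]
        rintro rfl
        exact hL.1 hy
    · rintro ⟨ψ, hψ, rfl⟩
      exact ⟨ψ x, _, (ih _).2 ⟨ψ, hψ, rfl⟩, rfl⟩

/-- Quantification over colourings with finitely many colours, that is, over sets of vertices. -/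
theorem exists_coloring {D : Type*} [Finite D] [Nonempty D]
    {Φ : ∀ W : Type, SimpleGraph W → (W → C) → (W → D) → Prop}
    (h : Definable E fun W G (χ : W → C × D) => Φ W G (fun x => (χ x).1) fun x => (χ x).2) :
    Definable E fun W G χ => ∃ ψ, Φ W G χ ψ := by
  refine of_finite fun χ₀ => ?_
  choose s step q₀ acc h using fun ψ₀ : Fin k → D => h fun j => (χ₀ j, ψ₀ j)
  refine ⟨∀ ψ₀, Set (Fin (s ψ₀)), inferInstance,
    fun μ b c S ψ₀ => {q' | ∃ d, ∃ q ∈ S ψ₀, step ψ₀ μ b (c, d) q = q'}, fun ψ₀ => {q₀ ψ₀},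
    {S | ∃ ψ₀, ∃ q ∈ S ψ₀, q ∈ acc ψ₀}, fun W G base L χ hL hχ => ?_⟩
  have key (ψ₀) := scan_map (G := G) (base := base) (χ := χ) (L := L) (q₀ := fun ψ₀ => {q₀ ψ₀})
    (step := fun μ b c S ψ₀ => {q' | ∃ d, ∃ q ∈ S ψ₀, step ψ₀ μ b (c, d) q = q'})
    (step' := fun μ b c S => {q' | ∃ d, ∃ q ∈ S, step ψ₀ μ b (c, d) q = q'})
    (f := fun S : ∀ ψ₀, Set (Fin (s ψ₀)) => S ψ₀) fun _ _ _ _ => rfl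
  have key (ψ₀ q) := (key ψ₀ ▸ mem_scan_powerset (step := step ψ₀) (χ := χ) (q₀ := q₀ ψ₀) hL.inj
    hL.nodup hL.disj ψ₀ q)
  simp only [Set.mem_ofPred_eq, key]
  constructor
  · rintro ⟨ψ, hψ⟩
    exact ⟨fun j => ψ (base j), _, ⟨ψ, fun _ => rfl, rfl⟩,
      (h _ W G base L (fun x => (χ x, ψ x)) hL fun j => by rw [hχ]).1 hψ⟩
  · rintro ⟨ψ₀, _, ⟨ψ, hψ, rfl⟩, hq⟩
    exact ⟨ψ, (h ψ₀ W G base L (fun x => (χ x, ψ x)) hL fun j => by rw [hχ, hψ]).2 hq⟩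

theorem forall_coloring {D : Type*} [Finite D] [Nonempty D]
    {Φ : ∀ W : Type, SimpleGraph W → (W → C) → (W → D) → Prop}
    (h : Definable E fun W G (χ : W → C × D) => Φ W G (fun x => (χ x).1) fun x => (χ x).2) :
    Definable E fun W G χ => ∀ ψ, Φ W G χ ψ := by
  simpa using (exists_coloring (Φ := fun W G χ ψ => ¬ Φ W G χ ψ) h.not).not

theorem exists_vertex (P : C → Prop) : Definable E fun _ _ χ => ∃ x, P (χ x) := by
  refine of_finite fun χ₀ => ⟨Prop, inferInstance, fun _ _ c q => q ∨ P c, False,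
    {q | q ∨ ∃ j, P (χ₀ j)}, fun W G base L χ hL hχ => ?_⟩
  have key : scan G base χ (fun _ _ c q => q ∨ P c) False L ↔ ∃ x ∈ L, P (χ x) := by
    clear hL
    induction L with
    | nil => simp [scan]
    | cons x L ih => simp [scan, ih, or_comm]
  rw [Set.mem_ofPred_eq, key]
  constructor
  · rintro ⟨x, hx⟩
    obtain ⟨j, rfl⟩ | h := hL.cover x
    · exact .inr ⟨j, hχ j ▸ hx⟩
    · exact .inl ⟨x, h, hx⟩
  · rintro (⟨x, -, hx⟩ | ⟨j, hj⟩)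
    · exact ⟨x, hx⟩
    · exact ⟨base j, hχ j ▸ hj⟩

/-- The automaton remembers the colour of the vertex that it has just read. -/
theorem exists_adj [Finite C] (T : C → C → Prop) :
    Definable E fun _ G χ => ∃ x y, G.Adj x y ∧ T (χ x) (χ y) := by
  have hor (a b c d : Prop) : ((a ∨ b) ∨ c ∨ d) ↔ (c ∨ a) ∨ d ∨ d ∨ b := by tauto
  refine of_finite fun χ₀ => ?_
  set S : C → C → Prop := fun c d => T c d ∨ T d c with hS
  set step : (Fin k → Prop) → Prop → C → Prop × Option C → Prop × Option C :=
    fun μ b c q => (q.1 ∨ (∃ j, μ j ∧ S c (χ₀ j)) ∨ (b ∧ ∃ d ∈ q.2, S c d), some c) with hstep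
  refine ⟨_, inferInstance, step, (False, none), {q | q.1 ∨ ∃ i j, E.Adj i j ∧ T (χ₀ i) (χ₀ j)},
    fun W G base L χ hL hχ => ?_⟩
  have key : ∀ L, IsLinear G L →
      (scan G base χ step (False, none) L).2 = L.head?.map χ ∧
      ((scan G base χ step (False, none) L).1 ↔ (∃ x ∈ L, ∃ j, G.Adj (base j) x ∧ S (χ x) (χ₀ j)) ∨
        ∃ x ∈ L, ∃ y ∈ L, G.Adj x y ∧ S (χ x) (χ y)) := by
    intro L hL
    induction L with
    | nil => simp [scan]
    | cons x L ih =>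
      obtain ⟨ih₁, ih₂⟩ := ih hL.1
      refine ⟨by simp [scan, hstep], ?_⟩
      have hx : ((∃ y ∈ L.head?, G.Adj x y) ∧ ∃ d ∈ L.head?.map χ, S (χ x) d) ↔
          ∃ y ∈ L, G.Adj x y ∧ S (χ x) (χ y) := by
        constructor
        · rintro ⟨⟨y, hy, hxy⟩, d, hd, h⟩
          rw [Option.mem_def] at hy
          rw [hy, Option.map_some, Option.mem_some_iff] at hd
          subst hd
          exact ⟨y, List.mem_of_mem_head? hy, hxy, h⟩
        · rintro ⟨y, hy, hxy, h⟩
          have := hL.2 y hy hxy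
          refine ⟨⟨y, this, hxy⟩, χ y, ?_, h⟩
          rw [Option.mem_def] at this ⊢
          rw [this, Option.map_some]
      simp only [scan]
      simp only [hstep]
      simp only [← hstep]
      rw [ih₁, ih₂, hx]
      simp only [List.mem_cons, exists_eq_or_imp, SimpleGraph.irrefl, false_and, false_or]
      have hsymm : (∃ y ∈ L, G.Adj y x ∧ S (χ y) (χ x)) ↔ ∃ y ∈ L, G.Adj x y ∧ S (χ x) (χ y) := by
        simp only [G.adj_comm x, hS, or_comm]
      have hsplit : (∃ y ∈ L, G.Adj y x ∧ S (χ y) (χ x) ∨ ∃ z ∈ L, G.Adj y z ∧ S (χ y) (χ z)) ↔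
          (∃ y ∈ L, G.Adj x y ∧ S (χ x) (χ y)) ∨
            ∃ y ∈ L, ∃ z ∈ L, G.Adj y z ∧ S (χ y) (χ z) := by
        rw [← hsymm]
        simp only [and_or_left, exists_or]
      rw [hsplit]
      exact hor _ _ _ _
  rw [Set.mem_ofPred_eq, (key L hL.linear).2]
  constructor
  · rintro ⟨x, y, hxy, h⟩
    obtain ⟨i, rfl⟩ | hx := hL.cover x <;> obtain ⟨j, rfl⟩ | hy := hL.cover y
    · exact .inr ⟨i, j, (hL.adj_base i j).1 hxy, by rwa [← hχ, ← hχ]⟩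
    · exact .inl (.inl ⟨y, hy, i, hxy, .inr (hχ i ▸ h)⟩)
    · exact .inl (.inl ⟨x, hx, j, hxy.symm, .inl (hχ j ▸ h)⟩)
    · exact .inl (.inr ⟨x, hx, y, hy, hxy, .inl h⟩)
  · rintro ((⟨x, -, j, h, h' | h'⟩ | ⟨x, -, y, -, h, h' | h'⟩) | ⟨i, j, h, h'⟩)
    · exact ⟨_, _, h.symm, (hχ j).symm ▸ h'⟩
    · exact ⟨_, _, h, (hχ j).symm ▸ h'⟩
    · exact ⟨x, y, h, h'⟩
    · exact ⟨y, x, h.symm, h'⟩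
    · exact ⟨_, _, (hL.adj_base i j).2 h, by rwa [hχ, hχ]⟩

end Definable

/-! ### Induced paths as minimal linking sets -/

section Links

variable {W : Type*} {G : SimpleGraph W} {Z A B : W → Prop} {a b : W}

/-- No partition of the set `Z` separates `A` from `B` in the subgraph of `G` induced by `Z`. -/
def Links (G : SimpleGraph W) (Z A B : W → Prop) : Prop :=
  ∀ ψ : W → Prop, (∃ x, A x ∧ ψ x) → (∃ x, B x ∧ ¬ ψ x) →
    ∃ x y, G.Adj x y ∧ (Z x ∧ ψ x) ∧ (Z y ∧ ¬ ψ y)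

/-- The set `Z` links `A` to `B`, and no proper subset of `Z` that contains `A` and `B` does. -/
def MinLinks (G : SimpleGraph W) (Z A B : W → Prop) : Prop :=
  Links G Z A B ∧ ∀ θ : W → Prop, (∀ x, A x → θ x) → (∀ x, B x → θ x) →
    Links G (fun x => Z x ∧ θ x) A B → ∀ x, Z x → θ x

theorem Links.reachable (h : Links G Z (· = a) (· = b)) (ha : Z a) (hb : Z b) :
    (G.induce {x | Z x}).Reachable ⟨a, ha⟩ ⟨b, hb⟩ := by
  by_contra hn
  obtain ⟨x, y, hxy, ⟨hx, hx', hr⟩, hy, hy'⟩ :=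
    h (fun x => ∃ hx : Z x, (G.induce {x | Z x}).Reachable ⟨a, ha⟩ ⟨x, hx⟩)
      ⟨a, rfl, ha, .refl _⟩ ⟨b, rfl, fun ⟨_, h⟩ => hn h⟩
  exact hy' ⟨hy, hr.trans (SimpleGraph.Adj.reachable (G := G.induce {x | Z x}) hxy)⟩

/-- A walk links its first vertex to its last: somewhere it leaves every set that contains the
former but not the latter. -/
theorem links_of_walk {g : ℕ → W} {n : ℕ} (h0 : g 0 = a) (hn : g n = b)
    (hZ : ∀ i ≤ n, Z (g i)) (hg : ∀ i < n, G.Adj (g i) (g (i + 1))) :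
    Links G Z (· = a) (· = b) := by
  rintro ψ ⟨_, rfl, hψa⟩ ⟨_, rfl, hψb⟩
  by_contra! hcon
  have key : ∀ i ≤ n, ψ (g i) := by
    intro i hi
    induction i with
    | zero => rwa [h0]
    | succ i ih =>
      by_contra hi'
      exact hi' (hcon _ _ (hg i hi) ⟨hZ i (by omega), ih (by omega)⟩ (hZ _ hi))
  exact hψb (hn ▸ key n le_rfl)

/-- A minimal set linking `a` to `b` consists of the vertices of a shortest path. -/
theorem MinLinks.exists_path (h : MinLinks G Z (· = a) (· = b)) (ha : Z a) (hb : Z b)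
    (hab : a ≠ b) (hadj : ¬ G.Adj a b) :
    ∃ n : ℕ, 1 ≤ n ∧ ∃ f : Fin n → W, Function.Injective f ∧
      (∀ x, (∃ i, f i = x) ↔ Z x ∧ x ≠ a ∧ x ≠ b) ∧
      (∀ i j, G.Adj (f i) (f j) ↔ (i.val + 1 = j.val ∨ j.val + 1 = i.val)) ∧
      (∀ i, G.Adj a (f i) ↔ i.val = 0) ∧ ∀ i, G.Adj b (f i) ↔ i.val + 1 = n := by
  obtain ⟨p, hp⟩ := (h.1.reachable ha hb).exists_walk_length_eq_dist
  set g : ℕ → W := fun i => (p.getVert i : W) with hg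
  have g0 : g 0 = a := by simp [hg]
  have gn : g p.length = b := by simp [hg]
  have hZ (i) : Z (g i) := (p.getVert i).2
  have hsucc (i) (hi : i < p.length) : G.Adj (g i) (g (i + 1)) := p.adj_getVert_succ hi
  have hinj (i j) (hi : i ≤ p.length) (hj : j ≤ p.length) (hij : g i = g j) : i = j :=
    (p.isPath_of_length_eq_dist hp).getVert_injOn hi hj (Subtype.ext hij)
  have hchord (i j) (hij : i < j) (hj : j ≤ p.length) (h : G.Adj (g i) (g j)) : i + 1 = j := by
    have h' : (G.induce {x | Z x}).Adj (p.getVert i) (p.getVert j) := h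
    have := SimpleGraph.dist_le ((p.take i).append (.cons h' (p.drop j)))
    rw [← hp, SimpleGraph.Walk.length_append, SimpleGraph.Walk.length_cons] at this
    simp at this
    omega
  have hadj' (i j) (hi : i ≤ p.length) (hj : j ≤ p.length) :
      G.Adj (g i) (g j) ↔ (i + 1 = j ∨ j + 1 = i) := by
    constructor
    · intro h
      obtain hij | rfl | hij := lt_trichotomy i j
      · exact .inl (hchord i j hij hj h)
      · exact absurd h (G.irrefl)
      · exact .inr (hchord j i hij hi h.symm)
    · rintro (rfl | rfl)
      · exact hsucc _ (by omega)
      · exact (hsucc _ (by omega)).symm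
  have hcover (x) (hx : Z x) : ∃ i ≤ p.length, g i = x :=
    h.2 (fun x => ∃ i ≤ p.length, g i = x) (fun x hx => ⟨0, by omega, hx ▸ g0⟩)
      (fun x hx => ⟨_, le_rfl, hx ▸ gn⟩)
      (links_of_walk g0 gn (fun i hi => ⟨hZ i, i, hi, rfl⟩) hsucc) x hx
  have hlen : 2 ≤ p.length := by
    by_contra! hlt
    have : p.length = 0 ∨ p.length = 1 := by omega
    obtain h0 | h1 := this
    · exact hab (by rw [← g0, ← gn, h0])
    · exact hadj (by rw [← g0, ← gn, h1]; exact hsucc 0 (by omega))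
  refine ⟨p.length - 1, by omega, fun i => g (i + 1), ?_, ?_, ?_, ?_, ?_⟩
  · intro i j hij
    have := hinj _ _ (by omega) (by omega) hij
    exact Fin.ext (by omega)
  · intro x
    constructor
    · rintro ⟨i, rfl⟩
      refine ⟨hZ _, fun h => ?_, fun h => ?_⟩
      · have := hinj _ _ (by omega) (by omega) (h.trans g0.symm)
        omega
      · have := hinj _ _ (by omega) (by omega) (h.trans gn.symm)
        omega
    · rintro ⟨hx, hxa, hxb⟩
      obtain ⟨i, hi, rfl⟩ := hcover x hx
      have h0 : i ≠ 0 := fun h => hxa (h ▸ g0)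
      have h1 : i ≠ p.length := fun h => hxb (h ▸ gn)
      exact ⟨⟨i - 1, by omega⟩, congrArg g (by simp; omega)⟩
  · intro i j
    rw [hadj' _ _ (by omega) (by omega)]
    omega
  · intro i
    have := hadj' 0 (i + 1) (by omega) (by omega)
    rw [g0] at this
    exact this.trans (by omega)
  · intro i
    have := hadj' p.length (i + 1) le_rfl (by omega)
    rw [gn] at this
    exact this.trans (by omega)

/-- Conversely, the vertices of an induced path form a minimal linking set. -/
theorem minLinks_of_path {n : ℕ} {f : Fin n → W} (hn : 1 ≤ n) (hadj : ¬ G.Adj a b)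
    (hf : ∀ i j, G.Adj (f i) (f j) ↔ (i.val + 1 = j.val ∨ j.val + 1 = i.val))
    (hfa : ∀ i, G.Adj a (f i) ↔ i.val = 0) (hfb : ∀ i, G.Adj b (f i) ↔ i.val + 1 = n)
    (hZ : ∀ x, Z x ↔ (∃ i, f i = x) ∨ x = a ∨ x = b) (hab : a ≠ b)
    (hb : ∀ i, f i ≠ b) : MinLinks G Z (· = a) (· = b) := by
  constructor
  · refine links_of_walk (n := n + 1)
      (g := fun i => if h : i - 1 < n ∧ i ≠ 0 then f ⟨i - 1, h.1⟩ else if i = 0 then a else b)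
      (by simp) (by simp) (fun i hi => ?_) fun i hi => ?_
    · rw [hZ]
      split_ifs <;> simp
    · obtain rfl | h0 := Nat.eq_zero_or_pos i
      · rw [dif_neg (by simp), if_pos rfl, dif_pos (by simp; omega), hfa]
      · obtain rfl | hlt := (Nat.lt_succ_iff.1 hi).eq_or_lt
        · have : i - 1 < i := by omega
          simp only [this, true_and, Nat.add_sub_cancel, lt_irrefl, false_and, dite_false]
          rw [dif_pos (by omega), if_neg (by omega), G.adj_comm, hfb]
          simp; omega
        · rw [dif_pos (by omega), dif_pos (by omega), hf]
          simp; omega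
  · intro θ hθa hθb hθ x hx
    obtain ⟨i, rfl⟩ | rfl | rfl := (hZ x).1 hx
    · by_contra hi
      -- without `f i`, the part of the path before it is closed under adjacency
      obtain ⟨x, y, hxy, ⟨⟨-, hxθ⟩, hx⟩, ⟨hyZ, hyθ⟩, hy⟩ := hθ (fun x => x = a ∨ ∃ j < i, f j = x)
        ⟨a, rfl, .inl rfl⟩ ⟨b, rfl, by
          rintro (h | ⟨j, -, h⟩)
          exacts [hab h.symm, hb j h]⟩
      rw [hZ] at hyZ
      push Not at hy
      obtain ⟨j', rfl⟩ | rfl | rfl := hyZ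
      · have hj' : i < j' := by
          refine lt_of_le_of_ne (le_of_not_gt fun h => hy.2 _ h rfl) ?_
          rintro rfl
          exact hi hyθ
        rw [Fin.lt_def] at hj'
        obtain rfl | ⟨j, hj, rfl⟩ := hx
        · rw [hfa] at hxy
          omega
        · rw [hf] at hxy
          rw [Fin.lt_def] at hj
          omega
      · exact hy.1 rfl
      · obtain rfl | ⟨j, hj, rfl⟩ := hx
        · exact hadj hxy
        · rw [G.adj_comm, hfb] at hxy
          rw [Fin.lt_def] at hj
          omega
    · exact hθa _ rfl
    · exact hθb _ rfl

end Links

/-! ### Containment of a pathograph by colourings -/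

namespace Pathograph

variable {W : Type*} {G : SimpleGraph W}

/-- A colouring of some of the vertices of `G` by the vertices and the urpaths of `F` that marks a
realization of `F` among the induced subgraphs of `G`. -/
structure IsColoring (F : Pathograph.{v}) (G : SimpleGraph W)
    (χ : W → Option (F.V ⊕ F.U)) : Prop where
  exists_vert : ∀ a, ∃ x, χ x = some (.inl a)
  unique_vert : ∀ a x y, χ x = some (.inl a) → χ y = some (.inl a) → x = y
  adj_vert : ∀ a b, F.E.Adj a b ↔ ∃ x y, G.Adj x y ∧ χ x = some (.inl a) ∧ χ y = some (.inl b)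
  path : ∀ p, ∃ a b, F.ends p = s(a, b) ∧
    MinLinks G (fun x => χ x = some (.inr p) ∨ χ x = some (.inl a) ∨ χ x = some (.inl b))
      (fun x => χ x = some (.inl a)) (fun x => χ x = some (.inl b))
  spoke : ∀ a p, a ∉ F.ends p →
    ((a, p) ∈ F.S ↔ ∃ x y, G.Adj x y ∧ χ x = some (.inl a) ∧ χ y = some (.inr p))
  rung : ∀ p q, p ≠ q →
    (F.R.Adj p q ↔ ∃ x y, G.Adj x y ∧ χ x = some (.inr p) ∧ χ y = some (.inr q))

theorem IsColoring.containedIn {F : Pathograph.{v}} {χ : W → Option (F.V ⊕ F.U)}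
    (h : F.IsColoring G χ) : F.ContainedIn G := by
  choose f hf using h.exists_vert
  have hf' (a x) : χ x = some (.inl a) ↔ x = f a :=
    ⟨fun hx => h.unique_vert a _ _ hx (hf a), fun hx => hx ▸ hf a⟩
  have hfinj : Function.Injective f := fun a b hab => by
    have := hf a
    rw [hab, hf b] at this
    simpa using this.symm
  have hadj (a b) : F.E.Adj a b ↔ G.Adj (f a) (f b) := by
    rw [h.adj_vert]
    simp [hf']
  choose left right hends hpath using h.path
  have hne (p) : left p ≠ right p := by
    have := F.ends_ne p
    rwa [hends, Sym2.mk_isDiag_iff] at this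
  have hnonadj (p) : ¬ F.E.Adj (left p) (right p) := by
    have := F.ends_nonadj p
    rwa [hends, SimpleGraph.mem_edgeSet] at this
  simp only [hf'] at hpath
  choose len hlen inner hinj hrange hinner hleft hright using fun p =>
    (hpath p).exists_path (by simp) (by simp) (hfinj.ne (hne p)) fun h => hnonadj p ((hadj _ _).2 h)
  have hinnerχ (p x) : χ x = some (.inr p) ↔ ∃ i, inner p i = x := by
    rw [hrange]
    constructor
    · intro hx
      exact ⟨.inl hx, by rintro rfl; simp [hf] at hx, by rintro rfl; simp [hf] at hx⟩
    · rintro ⟨hx | hx | hx, h₁, h₂⟩ <;> tauto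
  have hχ (p i) : χ (inner p i) = some (.inr p) := (hinnerχ p _).2 ⟨i, rfl⟩
  refine ⟨{x | χ x ≠ none}, ⟨{
    vert := fun a => ⟨f a, by simp [hf]⟩
    left := left
    right := right
    ends_eq := hends
    len := len
    one_le_len := hlen
    inner := fun p i => ⟨inner p i, by simp [hχ]⟩
    bijective := ?_
    adj_vert := fun a b => (hadj a b).symm
    adj_inner := hinner
    adj_left := hleft
    adj_right := hright
    adj_spoke := fun a p ha => ?_
    adj_rung := fun p q hpq => ?_ }⟩⟩
  · constructor
    · rintro (a | ⟨p, i⟩) (b | ⟨q, j⟩) hab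
      · simpa [hfinj.eq_iff] using hab
      · have : f a = inner q j := congrArg Subtype.val hab
        have := hχ q j ▸ this ▸ hf a
        simp at this
      · have : inner p i = f b := congrArg Subtype.val hab
        have := hχ p i ▸ this.symm ▸ hf b
        simp at this
      · have hab : inner p i = inner q j := congrArg Subtype.val hab
        obtain rfl : p = q := by
          have := hχ p i
          rw [hab, hχ] at this
          simpa using this.symm
        rw [hinj p hab]
    · rintro ⟨x, hx⟩
      obtain ⟨a | p, hx⟩ := Option.ne_none_iff_exists'.1 hx
      · exact ⟨.inl a, Subtype.ext ((hf' a x).1 hx).symm⟩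
      · obtain ⟨i, rfl⟩ := (hinnerχ p x).1 hx
        exact ⟨.inr ⟨p, i⟩, rfl⟩
  · rw [h.spoke a p ha]
    simp [hf', hinnerχ]
  · rw [h.rung p q hpq]
    simp [hinnerχ]

theorem containedIn_iff_exists_isColoring {F : Pathograph.{v}} :
    F.ContainedIn G ↔ ∃ χ, F.IsColoring G χ := by
  classical
  refine ⟨?_, fun ⟨χ, h⟩ => h.containedIn⟩
  rintro ⟨s, ⟨r⟩⟩
  set e := Equiv.ofBijective _ r.bijective with he
  let col : (F.V ⊕ Σ p, Fin (r.len p)) → F.V ⊕ F.U := Sum.map id Sigma.fst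
  let χ : W → Option (F.V ⊕ F.U) := fun x => if h : x ∈ s then some (col (e.symm ⟨x, h⟩)) else none
  have hχ (x c) : χ x = some c ↔ ∃ y, (e y : W) = x ∧ col y = c := by
    constructor
    · intro h
      by_cases hx : x ∈ s
      · exact ⟨e.symm ⟨x, hx⟩, by simp, by simpa [χ, hx] using h⟩
      · simp [χ, hx] at h
    · rintro ⟨y, rfl, rfl⟩
      simp [χ]
  have hvert (a x) : χ x = some (.inl a) ↔ x = r.vert a := by
    rw [hχ]
    simp [col, he, eq_comm]
  have hinner (p x) : χ x = some (.inr p) ↔ ∃ i, r.inner p i = x := by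
    rw [hχ]
    simp only [col, he, Sum.exists, Sum.map_inl, reduceCtorEq, and_false, exists_false, false_or,
      Sigma.exists, Sum.map_inr, Sum.inr.injEq, Equiv.ofBijective_apply, Sum.elim_inr]
    exact ⟨fun ⟨q, i, h, hq⟩ => by subst hq; exact ⟨i, h⟩, fun ⟨i, h⟩ => ⟨p, i, h, rfl⟩⟩
  have hne (a p i) : (r.inner p i : W) ≠ r.vert a := fun h => by
    have := r.bijective.1 (a₁ := .inr ⟨p, i⟩) (a₂ := .inl a) (Subtype.ext h)
    simp at this
  have hinj (a b) (h : (r.vert a : W) = r.vert b) : a = b := by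
    have := r.bijective.1 (a₁ := .inl a) (a₂ := .inl b) (Subtype.ext h)
    simpa using this
  refine ⟨χ, ⟨fun a => ⟨r.vert a, (hvert a _).2 rfl⟩, fun a x y hx hy => ?_, fun a b => ?_,
    fun p => ⟨r.left p, r.right p, r.ends_eq p, ?_⟩, fun a p ha => ?_, fun p q hpq => ?_⟩⟩
  · rw [hvert] at hx hy
    rw [hx, hy]
  · rw [← r.adj_vert]
    simp [hvert]
  · simp only [hvert, hinner]
    have hends := r.ends_eq p
    refine minLinks_of_path (f := fun i => (r.inner p i : W)) (r.one_le_len p) ?_ (r.adj_inner p)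
      (r.adj_left p) (r.adj_right p) (fun _ => Iff.rfl) ?_ fun i => hne _ _ _
    · have := F.ends_nonadj p
      rwa [hends, SimpleGraph.mem_edgeSet, ← r.adj_vert] at this
    · have := F.ends_ne p
      rw [hends, Sym2.mk_isDiag_iff] at this
      exact fun h => this (hinj _ _ h)
  · rw [r.adj_spoke a p ha]
    simp [hvert, hinner]
  · rw [r.adj_rung p q hpq]
    simp [hinner]

end Pathograph

/-! ### Containment is recognized by an automaton -/

namespace Definable

variable {k : ℕ} {E : SimpleGraph (Fin k)} {C : Type*}

theorem links [Finite C] {D : Type*} {f : C → D} (Z A B : D → Prop) :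
    Definable E fun _ G (χ : _ → C) =>
      Links G (fun x => Z (f (χ x))) (fun x => A (f (χ x))) fun x => B (f (χ x)) :=
  forall_coloring <| (exists_vertex fun c : C × Prop => A (f c.1) ∧ c.2).imp <|
    (exists_vertex fun c : C × Prop => B (f c.1) ∧ ¬ c.2).imp <|
    exists_adj fun c d : C × Prop => (Z (f c.1) ∧ c.2) ∧ (Z (f d.1) ∧ ¬ d.2)

theorem minLinks [Finite C] (Z A B : C → Prop) :
    Definable E fun _ G χ =>
      MinLinks G (fun x => Z (χ x)) (fun x => A (χ x)) fun x => B (χ x) := by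
  refine (links (f := id) Z A B).and <| forall_coloring (D := Prop) ?_
  have hsub (P : C → Prop) : Definable E fun _ _ (χ : _ → C × Prop) =>
      ∀ x, P (χ x).1 → (χ x).2 := by
    simpa using (exists_vertex (E := E) fun c : C × Prop => P c.1 ∧ ¬ c.2).not
  exact (hsub A).imp <| (hsub B).imp <|
    (links (f := id) (fun c : C × Prop => Z c.1 ∧ c.2) (fun c => A c.1) fun c => B c.1).imp (hsub Z)

theorem subsingleton (P : C → Prop) :
    Definable E fun _ _ χ => ∀ x y, P (χ x) → P (χ y) → x = y := by
  have h := forall_coloring (D := Prop)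
    (Φ := fun W _ χ ψ => ¬ ((∃ x : W, P (χ x) ∧ ψ x) ∧ ∃ x, P (χ x) ∧ ¬ ψ x))
    ((exists_vertex (E := E) fun c : C × Prop => P c.1 ∧ c.2).and
      (exists_vertex fun c => P c.1 ∧ ¬ c.2)).not
  refine h.congr fun W G χ => ⟨fun h x y hx hy => ?_, ?_⟩
  · by_contra hxy
    exact h (· = x) ⟨⟨x, hx, rfl⟩, y, hy, fun h => hxy h.symm⟩
  · rintro h ψ ⟨⟨x, hx, hψx⟩, y, hy, hψy⟩
    exact hψy (h x y hx hy ▸ hψx)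

theorem isColoring (F : Pathograph.{v}) : Definable E fun _ G χ => F.IsColoring G χ := by
  have := F.finite_V
  have := F.finite_U
  have vert := forall_finite fun a => exists_vertex (E := E) fun c : Option (F.V ⊕ F.U) =>
    c = some (.inl a)
  have unique := forall_finite fun a => subsingleton (E := E) fun c : Option (F.V ⊕ F.U) =>
    c = some (.inl a)
  have adj (c d : Option (F.V ⊕ F.U)) := exists_adj (E := E) fun c' d' => c' = c ∧ d' = d
  have edge := forall_finite fun a => forall_finite fun b =>
    (const (E := E) (F.E.Adj a b)).iff (adj (some (.inl a)) (some (.inl b)))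
  have path := forall_finite fun p => exists_finite fun a => exists_finite fun b =>
    (const (E := E) (F.ends p = s(a, b))).and <| minLinks
      (fun c : Option (F.V ⊕ F.U) => c = some (.inr p) ∨ c = some (.inl a) ∨ c = some (.inl b))
      (fun c => c = some (.inl a)) fun c => c = some (.inl b)
  have spoke := forall_finite fun a => forall_finite fun p => (const (E := E) (a ∉ F.ends p)).imp <|
    (const ((a, p) ∈ F.S)).iff (adj (some (.inl a)) (some (.inr p)))
  have rung := forall_finite fun p => forall_finite fun q => (const (E := E) (p ≠ q)).imp <|
    (const (F.R.Adj p q)).iff (adj (some (.inr p)) (some (.inr q)))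
  exact (vert.and <| unique.and <| edge.and <| path.and <| spoke.and rung).congr fun W G χ =>
    ⟨fun ⟨h₁, h₂, h₃, h₄, h₅, h₆⟩ => ⟨h₁, h₂, h₃, h₄, h₅, h₆⟩,
      fun ⟨h₁, h₂, h₃, h₄, h₅, h₆⟩ => ⟨h₁, h₂, h₃, h₄, h₅, h₆⟩⟩

theorem isFree {𝓕 : Set Pathograph.{v}} (h𝓕 : 𝓕.Finite) :
    Definable E fun _ G (_ : _ → Unit) => Pathograph.IsFree 𝓕 G := by
  have : Finite 𝓕 := h𝓕
  refine (forall_finite fun F : 𝓕 => ?_).congr (Φ := fun _ G (_ : _ → Unit) =>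
    ∀ F : 𝓕, ¬ F.1.ContainedIn G) fun W G χ => by simp [Pathograph.IsFree]
  have := F.1.finite_V
  have := F.1.finite_U
  simp only [Pathograph.containedIn_iff_exists_isColoring]
  refine (exists_coloring ?_).not
  exact comap (f := Prod.snd) (isColoring F.1)

end Definable

/-! ### Running programs -/

namespace RAM

@[simp] theorem State.reg_setReg (σ : State) (r x s : ℕ) :
    (σ.setReg r x).reg s = if s = r then x else σ.reg s := by
  simp [State.setReg, Function.update_apply]

@[simp] theorem State.arr_setReg (σ : State) (r x : ℕ) : (σ.setReg r x).arr = σ.arr := rfl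

@[simp] theorem State.reg_setArr (σ : State) (a i x : ℕ) : (σ.setArr a i x).reg = σ.reg := rfl

@[simp] theorem State.arr_setArr (σ : State) (a i x b : ℕ) :
    (σ.setArr a i x).arr b = if b = a then Function.update (σ.arr a) i x else σ.arr b := by
  simp [State.setArr, Function.update_apply]

@[simp] theorem State.setReg_setReg (σ : State) (r x y : ℕ) :
    (σ.setReg r x).setReg r y = σ.setReg r y := by
  simp [State.setReg]

namespace Program

/-- The program contains no loop. -/
def LoopFree : Program → Prop
  | .seq P Q | .cond _ P Q => P.LoopFree ∧ Q.LoopFree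
  | .loop _ _ => False
  | _ => True

/-- A bound on the number of steps of a loop-free program. -/
def cost : Program → ℕ
  | .seq P Q | .cond _ P Q => 1 + P.cost + Q.cost
  | _ => 1

open Classical in
/-- The final state of a loop-free program. Loops, for which there need be no final state, are
skipped. -/
noncomputable def exec : Program → State → State
  | .skip, σ | .loop _ _, σ => σ
  | .const r c, σ => σ.setReg r c
  | .copy r s, σ => σ.setReg r (σ.reg s)
  | .succ r, σ => σ.setReg r (σ.reg r + 1)
  | .pred r, σ => σ.setReg r (σ.reg r - 1)
  | .load r a i, σ => σ.setReg r (σ.arr a (σ.reg i))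
  | .store a i r, σ => σ.setArr a (σ.reg i) (σ.reg r)
  | .seq P Q, σ => Q.exec (P.exec σ)
  | .cond b P Q, σ => if b.Holds σ then P.exec σ else Q.exec σ

theorem exists_runs_exec {P : Program} (hP : P.LoopFree) (σ : State) :
    ∃ t ≤ P.cost, Runs P σ t (P.exec σ) := by
  induction P generalizing σ with
  | seq P Q ihP ihQ =>
    obtain ⟨t, ht, h⟩ := ihP hP.1 σ
    obtain ⟨t', ht', h'⟩ := ihQ hP.2 (P.exec σ)
    exact ⟨t + t', by rw [cost]; omega, .seq h h'⟩
  | cond b P Q ihP ihQ =>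
    by_cases hb : b.Holds σ
    · obtain ⟨t, ht, h⟩ := ihP hP.1 σ
      exact ⟨1 + t, by rw [cost]; omega, by rw [exec, if_pos hb]; exact .cond_true hb h⟩
    · obtain ⟨t, ht, h⟩ := ihQ hP.2 σ
      exact ⟨1 + t, by rw [cost]; omega, by rw [exec, if_neg hb]; exact .cond_false hb h⟩
  | loop => exact hP.elim
  | _ => exact ⟨1, le_rfl, by constructor⟩

/-- A loop halts if each round of it uses up some of the fuel `f` that the invariant provides. -/
theorem exists_runs_loop {P : Program} {b : Test} (hP : P.LoopFree) {Inv : ℕ → State → Prop}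
    (hInv : ∀ f σ, Inv f σ → b.Holds σ → ∃ f' < f, Inv f' (P.exec σ)) (f : ℕ) (σ : State)
    (h : Inv f σ) : ∃ t τ, Runs (.loop b P) σ t τ ∧ t ≤ (P.cost + 1) * f + 1 ∧ ¬ b.Holds τ ∧
      ∃ f', Inv f' τ := by
  induction f using Nat.strong_induction_on generalizing σ with
  | _ f ih =>
    by_cases hb : b.Holds σ
    · obtain ⟨f', hf', h'⟩ := hInv f σ h hb
      obtain ⟨t, ht, hrun⟩ := exists_runs_exec hP σ
      obtain ⟨t', τ, hrun', ht', hτ⟩ := ih f' hf' _ h'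
      refine ⟨1 + t + t', τ, .loop_true hb hrun hrun', ?_, hτ⟩
      have : (P.cost + 1) * (f' + 1) ≤ (P.cost + 1) * f := Nat.mul_le_mul_left _ hf'
      rw [Nat.mul_add_one] at this
      omega
    · exact ⟨1, σ, .loop_false hb, by omega, hb, f, h⟩

/-- Branch on the value of register `r`, which should be below `N`. Register `z` holds the
constants that `r` is compared with. -/
def switch (r z : ℕ) : ℕ → (ℕ → Program) → Program
  | 0, _ => .skip
  | N + 1, P => .seq (.const z N) (.cond (.eq r z) (P N) (switch r z N P))

theorem loopFree_switch {r z N : ℕ} {P : ℕ → Program} (hP : ∀ i, (P i).LoopFree) :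
    (switch r z N P).LoopFree := by
  induction N with
  | zero => trivial
  | succ N ih => exact ⟨trivial, hP N, ih⟩

theorem exec_switch {r z N : ℕ} {P : ℕ → Program} {σ : State} (hrz : r ≠ z) (hN : σ.reg r < N) :
    (switch r z N P).exec σ = (P (σ.reg r)).exec (σ.setReg z (σ.reg r)) := by
  induction N generalizing σ with
  | zero => omega
  | succ N ih =>
    rw [switch, exec, exec, exec]
    by_cases h : σ.reg r = N
    · simp [Test.Holds, hrz, h]
    · rw [if_neg (by simpa [Test.Holds, hrz] using h), ih (by simp [hrz]; omega)]
      simp [hrz]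

end Program

end RAM

/-! ### Traversing the paths -/

section Trail

variable {V : Type*} {G : SimpleGraph V} {N : V → Prop} {L : List V} {x y : V}

/-- The list `L` lays out a union of components of the subgraph of `G` induced by `N`. -/
structure ClosedTrail (G : SimpleGraph V) (N : V → Prop) (L : List V) : Prop where
  nodup : L.Nodup
  inner : ∀ y ∈ L, N y
  linear : IsLinear G L
  closed : ∀ y ∈ L, ∀ z, N z → G.Adj y z → z ∈ L

/-- The list `x :: L` lays out a union of components of the subgraph of `G` induced by `N`, except
that the component of `x` may continue beyond `x`. -/
structure OpenTrail (G : SimpleGraph V) (N : V → Prop) (x : V) (L : List V) : Prop where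
  nodup : (x :: L).Nodup
  inner : ∀ y ∈ x :: L, N y
  linear : IsLinear G (x :: L)
  closed : ∀ y ∈ L, ∀ z, N z → G.Adj y z → z ∈ x :: L
  start : (∀ z z', N z → N z' → G.Adj x z → G.Adj x z' → z = z') ∨ ∃ z ∈ L, G.Adj x z

theorem ClosedTrail.nil : ClosedTrail G N [] := ⟨by simp, by simp, trivial, by simp⟩

theorem ClosedTrail.not_adj (h : ClosedTrail G N L) (hy : N y) (hyL : y ∉ L) :
    ∀ z ∈ L, ¬ G.Adj y z :=
  fun z hz hyz => hyL (h.closed z hz y hy hyz.symm)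

theorem ClosedTrail.cons (h : ClosedTrail G N L) (hy : N y) (hyL : y ∉ L)
    (hdeg : ∀ z z', N z → N z' → G.Adj y z → G.Adj y z' → z = z') : OpenTrail G N y L where
  nodup := List.nodup_cons.2 ⟨hyL, h.nodup⟩
  inner := by simpa using ⟨hy, h.inner⟩
  linear := ⟨h.linear, fun z hz hyz => absurd hyz (h.not_adj hy hyL z hz)⟩
  closed := fun z hz z' hz' hzz' => List.mem_cons_of_mem _ (h.closed z hz z' hz' hzz')
  start := .inl hdeg

theorem OpenTrail.closedTrail (h : OpenTrail G N x L)
    (hx : ∀ z, N z → G.Adj x z → z ∈ x :: L) : ClosedTrail G N (x :: L) where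
  nodup := h.nodup
  inner := h.inner
  linear := h.linear
  closed := by
    intro y hy z hz hyz
    obtain rfl | hy := List.mem_cons.1 hy
    · exact hx z hz hyz
    · exact h.closed y hy z hz hyz

/-- As `x` has at most two neighbours, one of which precedes it unless `x` has just one neighbour,
the trail can be continued in only one way. -/
theorem OpenTrail.cons (h : OpenTrail G N x L) (hy : N y) (hyL : y ∉ x :: L) (hxy : G.Adj x y)
    (hdeg : ∀ z₁ z₂ z₃, N z₁ → N z₂ → N z₃ → G.Adj x z₁ → G.Adj x z₂ → G.Adj x z₃ →
      z₁ = z₂ ∨ z₁ = z₃ ∨ z₂ = z₃) : OpenTrail G N y (x :: L) where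
  nodup := List.nodup_cons.2 ⟨hyL, h.nodup⟩
  inner := by
    rintro z (_ | ⟨_, hz⟩)
    exacts [hy, h.inner z hz]
  linear := by
    refine ⟨h.linear, fun z hz hyz => ?_⟩
    obtain rfl | hz := List.mem_cons.1 hz
    · rfl
    · exact absurd (h.closed z hz y hy hyz.symm) hyL
  closed := by
    intro z hz w hw hzw
    obtain rfl | hz := List.mem_cons.1 hz
    · obtain h' | ⟨u, hu, hzu⟩ := h.start
      · simp [h' w y hw hy hzw hxy]
      · obtain rfl | rfl | rfl := hdeg u y w (h.inner u (by simp [hu])) hy hw hzu hxy hzw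
        · exact absurd (List.mem_cons_of_mem _ hu) hyL
        · simp [hu]
        · simp
    · exact List.mem_cons_of_mem _ (h.closed z hz w hw hzw)
  start := .inr ⟨x, by simp, hxy.symm⟩

end Trail

/-! ### The program -/

namespace RAM

/-! Vertex `y` is represented by the number `y + 1`, and `0` stands for no vertex. Inner vertices
are those with label `0`. Arrays `3` and `4` hold the inner neighbours of the inner vertices, array
`5` holds the sets of labels of their labelled neighbours, in binary, and array `6` tells which of
them have been traversed; its cell `0` is nonzero, so that the number `0` is never taken for a
vertex to move to. Registers `9` and `12` hold zero and the constants of branchings, registers `10`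
and `11` hold intermediate results. -/

namespace Program

/-- Record that the vertex in register `b`, whose label is in register `lb`, has the neighbour in
register `a`, whose label is in register `la`. -/
def halfEdge (k a la b lb : ℕ) : Program :=
  .cond (.eq lb 9)
    (.cond (.eq la 9)
      (.seq (.load 10 3 b) (.cond (.eq 10 9) (.store 3 b a) (.store 4 b a)))
      (.seq (.load 10 5 b)
        (.seq (switch la 12 (k + 1) fun l => switch 10 12 (2 ^ k) fun c =>
            .const 11 (c ||| 2 ^ (l - 1)))
          (.store 5 b 11))))
    .skip

/-- Record edge number `i`, where register `2` holds `i`. -/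
def recordEdge (k : ℕ) : Program :=
  .seq (.load 7 1 2) <| .seq (.load 8 2 2) <| .seq (.load 5 0 7) <| .seq (.load 6 0 8) <|
  .seq (.succ 7) <| .seq (.succ 8) <| .seq (halfEdge k 7 5 8 6) <| .seq (halfEdge k 8 6 7 5) <|
  .succ 2

/-- Move to the vertex in register `7`: update the state of the automaton, in register `4`, mark the
vertex as traversed, and make it the current vertex, in register `3`. -/
def visit (k s : ℕ) (δ : ℕ → ℕ → ℕ) : Program :=
  .seq (.load 10 5 7) <|
  .seq (switch 4 12 s fun q => switch 10 12 (2 ^ k) fun c => .const 4 (δ q c)) <|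
  .seq (.const 11 1) <| .seq (.store 6 7 11) <| .copy 3 7

/-- If there is a current vertex, then move on to a neighbour that has not been traversed yet, or
drop the current vertex if there is none. If there is no current vertex, then start at vertex `v`,
where register `2` holds `v`, provided that it is an inner vertex, has not been traversed yet, and
has at most one inner neighbour; otherwise increase `v`. -/
def traverse (k s : ℕ) (δ₀ δ₁ : ℕ → ℕ → ℕ) : Program :=
  .cond (.eq 3 9)
    (.seq (.load 5 0 2) <| .seq (.copy 7 2) <| .seq (.succ 7) <| .seq (.load 6 6 7) <|
      .seq (.load 8 4 7) <|
      .cond (.eq 5 9) (.cond (.eq 6 9) (.cond (.eq 8 9) (visit k s δ₀) (.succ 2)) (.succ 2))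
        (.succ 2))
    (.seq (.load 7 3 3) <| .seq (.load 6 6 7) <| .cond (.eq 6 9) (visit k s δ₁) <|
      .seq (.load 7 4 3) <| .seq (.load 6 6 7) <| .cond (.eq 6 9) (visit k s δ₁) (.const 3 0))

/-- Record all edges, run the automaton along the paths, and answer according to its final state. -/
def decider (k s : ℕ) (δ₀ δ₁ : ℕ → ℕ → ℕ) (q₀ : ℕ) (ans : ℕ → ℕ) : Program :=
  .seq (.loop (.lt 2 1) (recordEdge k)) <|
  .seq (.seq (.const 2 0) <| .seq (.const 4 q₀) <| .seq (.const 11 1) (.store 6 9 11)) <|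
  .seq (.loop (.lt 2 0) (traverse k s δ₀ δ₁)) <| switch 4 12 s fun q => .const 0 (ans q)

/-- The number of steps of `decider` per unit of the size of the input. -/
def slope (k s : ℕ) (δ₀ δ₁ : ℕ → ℕ → ℕ) (ans : ℕ → ℕ) : ℕ :=
  (recordEdge k).cost + 5 * (traverse k s δ₀ δ₁).cost +
    (switch 4 12 s fun q => .const 0 (ans q)).cost + 12

theorem exec_visit {k s : ℕ} {δ : ℕ → ℕ → ℕ} {σ : State} (hq : σ.reg 4 < s)
    (hc : σ.arr 5 (σ.reg 7) < 2 ^ k) : (visit k s δ).exec σ =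
      ((((((σ.setReg 10 (σ.arr 5 (σ.reg 7))).setReg 12 (σ.reg 4)).setReg 12
        (σ.arr 5 (σ.reg 7))).setReg 4 (δ (σ.reg 4) (σ.arr 5 (σ.reg 7)))).setReg 11 1).setArr 6
        (σ.reg 7) 1).setReg 3 (σ.reg 7) := by
  rw [visit, exec, exec, exec, exec_switch (by omega) (by simpa using hq),
    exec_switch (by omega) (by simpa using hc)]
  simp [exec]

theorem loopFree_recordEdge (k : ℕ) : (recordEdge k).LoopFree := by
  have h (r) : (switch r 12 (k + 1) fun l => switch 10 12 (2 ^ k) fun c =>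
      .const 11 (c ||| 2 ^ (l - 1))).LoopFree :=
    loopFree_switch fun _ => loopFree_switch fun _ => trivial
  simp [recordEdge, halfEdge, LoopFree, h]

theorem loopFree_traverse (k s : ℕ) (δ₀ δ₁ : ℕ → ℕ → ℕ) : (traverse k s δ₀ δ₁).LoopFree := by
  have h (δ : ℕ → ℕ → ℕ) : (switch 4 12 s fun q => switch 10 12 (2 ^ k) fun c =>
      .const 4 (δ q c)).LoopFree :=
    loopFree_switch fun _ => loopFree_switch fun _ => trivial
  simp [traverse, visit, LoopFree, h]

end Program

/-! ### Recording the edges -/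

/-- The arrays `3`, `4` and `5` describe the neighbours of the inner vertices, as far as these are
told by the set `D` of ordered pairs. -/
structure Recorded (k : ℕ) {n : ℕ} (lab : Fin n → ℕ) (D : Set (Fin n × Fin n))
    (arr : ℕ → ℕ → ℕ) : Prop where
  code_lt : ∀ y, lab y = 0 → arr 5 (y + 1) < 2 ^ k
  code : ∀ y, lab y = 0 → ∀ j, (arr 5 (y + 1)).testBit j = true ↔ ∃ x, (x, y) ∈ D ∧ lab x = j + 1
  sound_fst : ∀ y, lab y = 0 → arr 3 (y + 1) ≠ 0 →
    ∃ x : Fin n, arr 3 (y + 1) = x + 1 ∧ (x, y) ∈ D ∧ lab x = 0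
  sound_snd : ∀ y, lab y = 0 → arr 4 (y + 1) ≠ 0 →
    ∃ x : Fin n, arr 4 (y + 1) = x + 1 ∧ (x, y) ∈ D ∧ lab x = 0
  complete : ∀ x y, lab x = 0 → lab y = 0 → (x, y) ∈ D →
    arr 3 (y + 1) = x + 1 ∨ arr 4 (y + 1) = x + 1
  ne : ∀ y, lab y = 0 → arr 4 (y + 1) ≠ 0 →
    arr 3 (y + 1) ≠ 0 ∧ arr 3 (y + 1) ≠ arr 4 (y + 1)

namespace Recorded

variable {k n : ℕ} {lab : Fin n → ℕ} {D : Set (Fin n × Fin n)} {σ : State} {x y : Fin n}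

theorem empty {arr : ℕ → ℕ → ℕ} (h : ∀ a, 3 ≤ a → ∀ i, arr a i = 0) : Recorded k lab ∅ arr := by
  constructor <;> simp [h]

/-- The step for a labelled target, about which nothing is recorded. -/
theorem insert_of_ne_zero {arr : ℕ → ℕ → ℕ} (h : Recorded k lab D arr) (hy : lab y ≠ 0) :
    Recorded k lab (insert (x, y) D) arr := by
  have key (z w) (hw : lab w = 0) : (z, w) ∈ insert (x, y) D ↔ (z, w) ∈ D := by
    rw [Set.mem_insert_iff, or_iff_right]
    rintro h
    rw [Prod.mk.injEq] at h
    exact hy (h.2 ▸ hw)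
  refine ⟨h.code_lt, fun z hz j => ?_, fun z hz => ?_, fun z hz => ?_, fun z w hz hw => ?_, h.ne⟩
  · simp only [key _ z hz, h.code z hz]
  · simpa only [key _ z hz] using h.sound_fst z hz
  · simpa only [key _ z hz] using h.sound_snd z hz
  · simpa only [key z w hw] using h.complete z w hz hw

theorem insert_of_label {arr arr' : ℕ → ℕ → ℕ} (h : Recorded k lab D arr) (hx : lab x ≠ 0)
    (hxk : lab x ≤ k) (hy : lab y = 0) (h3 : arr' 3 = arr 3) (h4 : arr' 4 = arr 4)
    (h5 : arr' 5 = Function.update (arr 5) (y + 1) (arr 5 (y + 1) ||| 2 ^ (lab x - 1))) :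
    Recorded k lab (insert (x, y) D) arr' := by
  have key (z w) (hz : lab z = 0) : (z, w) ∈ insert (x, y) D ↔ (z, w) ∈ D := by
    rw [Set.mem_insert_iff, or_iff_right]
    rintro h
    rw [Prod.mk.injEq] at h
    exact hx (h.1 ▸ hz)
  have hne (w) (hw : w ≠ y) : arr' 5 (w + 1) = arr 5 (w + 1) := by
    rw [h5, Function.update_of_ne]
    simpa [Fin.ext_iff] using hw
  have heq : arr' 5 (y + 1) = arr 5 (y + 1) ||| 2 ^ (lab x - 1) := by
    rw [h5, Function.update_self]
  refine ⟨fun w hw => ?_, fun w hw j => ?_, fun w hw hne => ?_, fun w hw hne => ?_,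
    fun z w hz hw hzw => ?_, fun w hw => ?_⟩
  · by_cases hwy : w = y
    · subst hwy
      rw [heq]
      exact Nat.or_lt_two_pow (h.code_lt w hw) (Nat.pow_lt_pow_right (by omega) (by omega))
    · rw [hne w hwy]
      exact h.code_lt w hw
  · by_cases hwy : w = y
    · subst hwy
      rw [heq, Nat.testBit_or, Bool.or_eq_true, h.code w hw, Nat.testBit_two_pow,
        decide_eq_true_iff]
      constructor
      · rintro (⟨z, hz, hzj⟩ | rfl)
        · exact ⟨z, .inr hz, hzj⟩
        · exact ⟨x, .inl rfl, by omega⟩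
      · rintro ⟨z, hz | hz, hzj⟩
        · rw [Prod.mk.injEq] at hz
          rw [hz.1] at hzj
          exact .inr (by omega)
        · exact .inl ⟨z, hz, hzj⟩
    · rw [hne w hwy, h.code w hw]
      simp [hwy]
  · rw [h3] at hne ⊢
    obtain ⟨z, hz, hzD, hz0⟩ := h.sound_fst w hw hne
    exact ⟨z, hz, .inr hzD, hz0⟩
  · rw [h4] at hne ⊢
    obtain ⟨z, hz, hzD, hz0⟩ := h.sound_snd w hw hne
    exact ⟨z, hz, .inr hzD, hz0⟩
  · rw [h3, h4]
    exact h.complete z w hz hw ((key z w hz).1 hzw)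
  · rw [h3, h4]
    exact h.ne w hw

/-- A first inner neighbour goes into array `3`, and a second one into array `4`. As there is no
third one, nothing is overwritten. -/
theorem insert_of_inner {arr arr' : ℕ → ℕ → ℕ} (h : Recorded k lab D arr) (hx : lab x = 0)
    (hy : lab y = 0) (hxy : (x, y) ∉ D)
    (hdeg : ∀ z₁ z₂, lab z₁ = 0 → lab z₂ = 0 → (z₁, y) ∈ D → (z₂, y) ∈ D → z₁ = z₂)
    (h5 : arr' 5 = arr 5)
    (h3 : arr' 3 = if arr 3 (y + 1) = 0 then Function.update (arr 3) (y + 1) (x + 1) else arr 3)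
    (h4 : arr' 4 = if arr 3 (y + 1) = 0 then arr 4 else Function.update (arr 4) (y + 1) (x + 1)) :
    Recorded k lab (insert (x, y) D) arr' := by
  have hne3 (w) (hw : w ≠ y) : arr' 3 (w + 1) = arr 3 (w + 1) := by
    rw [h3]
    split_ifs
    · rw [Function.update_of_ne]
      simpa [Fin.ext_iff] using hw
    · rfl
  have hne4 (w) (hw : w ≠ y) : arr' 4 (w + 1) = arr 4 (w + 1) := by
    rw [h4]
    split_ifs
    · rfl
    · rw [Function.update_of_ne]
      simpa [Fin.ext_iff] using hw
  have heq3 : arr' 3 (y + 1) = if arr 3 (y + 1) = 0 then (x + 1 : ℕ) else arr 3 (y + 1) := by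
    rw [h3]
    split_ifs <;> simp
  have heq4 : arr' 4 (y + 1) = if arr 3 (y + 1) = 0 then arr 4 (y + 1) else x + 1 := by
    rw [h4]
    split_ifs <;> simp
  -- array `4` is still free, since its entry would be a second inner neighbour
  have hfree : arr 4 (y + 1) = 0 := by
    by_contra h4
    obtain ⟨z, hz, hzD, hz0⟩ := h.sound_snd y hy h4
    obtain ⟨w, hw, hwD, hw0⟩ := h.sound_fst y hy (h.ne y hy h4).1
    apply (h.ne y hy h4).2
    rw [hz, hw, hdeg z w hz0 hw0 hzD hwD]
  have key (z w) (hw : w ≠ y) : (z, w) ∈ insert (x, y) D ↔ (z, w) ∈ D := by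
    simp [hw]
  refine ⟨fun w hw => ?_, fun w hw j => ?_, fun w hw => ?_, fun w hw => ?_,
    fun z w hz hw => ?_, fun w hw => ?_⟩
  · rw [h5]
    exact h.code_lt w hw
  · rw [h5, h.code w hw]
    refine exists_congr fun z => and_congr_left fun hz => ?_
    rw [Set.mem_insert_iff, or_iff_right]
    intro hzw
    rw [Prod.mk.injEq] at hzw
    rw [hzw.1, hx] at hz
    omega
  all_goals by_cases hwy : w = y
  · subst hwy
    rw [heq3]
    split_ifs with h0
    · exact fun _ => ⟨x, rfl, .inl rfl, hx⟩
    · intro _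
      obtain ⟨z, hz, hzD, hz0⟩ := h.sound_fst w hw h0
      exact ⟨z, hz, .inr hzD, hz0⟩
  · simpa only [hne3 w hwy, key _ w hwy] using h.sound_fst w hw
  · subst hwy
    rw [heq4]
    split_ifs with h0
    · exact fun h => absurd hfree h
    · exact fun _ => ⟨x, rfl, .inl rfl, hx⟩
  · simpa only [hne4 w hwy, key _ w hwy] using h.sound_snd w hw
  · subst hwy
    rw [heq3, heq4]
    rintro (hzw | hzw)
    · rw [Prod.mk.injEq] at hzw
      rw [hzw.1]
      split_ifs <;> simp
    · obtain hz3 | hz4 := h.complete z w hz hw hzw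
      · left
        rw [if_neg (by omega), hz3]
      · omega
  · simpa only [hne3 w hwy, hne4 w hwy, key _ w hwy] using h.complete z w hz hw
  · subst hwy
    rw [heq3, heq4]
    split_ifs with h0
    · exact fun h => absurd hfree h
    · intro _
      refine ⟨h0, fun hxw => hxy ?_⟩
      obtain ⟨z, hz, hzD, -⟩ := h.sound_fst w hw h0
      obtain rfl : z = x := Fin.ext (by omega)
      exact hzD
  · simpa only [hne3 w hwy, hne4 w hwy] using h.ne w hw

theorem halfEdge {a la b lb : ℕ} (h : Recorded k lab D σ.arr) (hxk : lab x ≤ k)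
    (hxy : (x, y) ∉ D)
    (hdeg : lab x = 0 → lab y = 0 → ∀ z₁ z₂, lab z₁ = 0 → lab z₂ = 0 → (z₁, y) ∈ D →
      (z₂, y) ∈ D → z₁ = z₂)
    (ha : σ.reg a = x + 1) (hla : σ.reg la = lab x) (hb : σ.reg b = y + 1) (hlb : σ.reg lb = lab y)
    (h9 : σ.reg 9 = 0) (ha' : a < 9) (hla' : la < 9) (hb' : b < 9) :
    Recorded k lab (insert (x, y) D) ((Program.halfEdge k a la b lb).exec σ).arr ∧
      (∀ r < 10, ((Program.halfEdge k a la b lb).exec σ).reg r = σ.reg r) ∧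
      ∀ c, (c < 3 ∨ 6 ≤ c) → ((Program.halfEdge k a la b lb).exec σ).arr c = σ.arr c := by
  by_cases hy : lab y = 0
  swap
  · have : (Program.halfEdge k a la b lb).exec σ = σ := by
      simp [Program.halfEdge, Program.exec, Test.Holds, hlb, h9, hy]
    rw [this]
    exact ⟨h.insert_of_ne_zero hy, by simp, by simp⟩
  by_cases hx : lab x = 0
  · have : (Program.halfEdge k a la b lb).exec σ = if σ.arr 3 (y + 1) = 0
        then (σ.setReg 10 (σ.arr 3 (y + 1))).setArr 3 (y + 1) (x + 1)
        else (σ.setReg 10 (σ.arr 3 (y + 1))).setArr 4 (y + 1) (x + 1) := by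
      simp [Program.halfEdge, Program.exec, Test.Holds, hlb, hla, hb, ha, h9, hy, hx, 
        (show b ≠ 10 by omega), (show a ≠ 10 by omega)]
    rw [this]
    refine ⟨h.insert_of_inner hx hy hxy (hdeg hx hy) ?_ ?_ ?_, fun r hr => ?_, fun c hc => ?_⟩
    · split_ifs <;> simp
    · split_ifs <;> simp
    · split_ifs <;> simp
    · split_ifs <;> simp <;> omega
    · have h3 : c ≠ 3 := by omega
      have h4 : c ≠ 4 := by omega
      split_ifs <;> simp [h3, h4]
  · have : (Program.halfEdge k a la b lb).exec σ =
        ((((σ.setReg 10 (σ.arr 5 (y + 1))).setReg 12 (lab x)).setReg 12 (σ.arr 5 (y + 1))).setReg 11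
          (σ.arr 5 (y + 1) ||| 2 ^ (lab x - 1))).setArr 5 (y + 1)
          (σ.arr 5 (y + 1) ||| 2 ^ (lab x - 1)) := by
      rw [Program.halfEdge, Program.exec, if_pos (by simp [Test.Holds, hlb, h9, hy]), Program.exec,
        if_neg (by simp [Test.Holds, hla, h9, hx]), Program.exec, Program.exec, Program.exec,
        Program.exec_switch (by omega)
          (by simp [(show la ≠ 10 by omega), hla]; omega),
        Program.exec_switch (by omega) (by simpa [hb] using h.code_lt y hy)]
      simp [Program.exec, hb, hla, (show la ≠ 10 by omega), (show b ≠ 10 by omega),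
        (show b ≠ 11 by omega), (show b ≠ 12 by omega)]
    rw [this]
    refine ⟨h.insert_of_label hx hxk hy ?_ ?_ ?_, fun r hr => ?_, fun c hc => ?_⟩
    · simp
    · simp
    · simp
    · simp only [State.reg_setArr, State.reg_setReg]
      rw [if_neg (by omega), if_neg (by omega), if_neg (by omega), if_neg (by omega)]
    · simp [show c ≠ 5 by omega]

end Recorded

end RAM

namespace LabelledEdgeList

open RAM

variable {I : LabelledEdgeList} {k : ℕ}

/-- The ordered pairs of ends of the first `i` edges. -/
def pairs (I : LabelledEdgeList) (i : ℕ) : Set (Fin I.n × Fin I.n) :=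
  {e | e ∈ I.edges.take i ∨ e.swap ∈ I.edges.take i}

theorem mem_pairs_m {x y : Fin I.n} : (x, y) ∈ I.pairs I.m ↔ I.graph.Adj x y := by
  simp [pairs, m, graph]

theorem adj_of_mem_pairs {i : ℕ} {x y : Fin I.n} (h : (x, y) ∈ I.pairs i) : I.graph.Adj x y :=
  h.imp List.mem_of_mem_take List.mem_of_mem_take

theorem pairs_succ {i : ℕ} (hi : i < I.m) :
    I.pairs (i + 1) = insert (I.edges[i]'hi).swap (insert (I.edges[i]'hi) (I.pairs i)) := by
  ext ⟨x, y⟩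
  simp only [pairs, Set.mem_ofPred_eq, Set.mem_insert_iff, ← List.take_append_getElem hi,
    List.mem_append, List.mem_singleton, Prod.swap_eq_iff_eq_swap]
  tauto

theorem getElem_notMem_pairs {i : ℕ} (hi : i < I.m) : I.edges[i]'hi ∉ I.pairs i := by
  have key (e) (he : e ∈ I.edges.take i) :
      s(e.1, e.2) ≠ s((I.edges[i]'hi).1, (I.edges[i]'hi).2) := by
    obtain ⟨j, hj, rfl⟩ := List.mem_iff_getElem.1 he
    rw [List.length_take] at hj
    have hji : j < i := by omega
    intro h
    have h' : (I.edges.map fun e => s(e.1, e.2))[j]'(by simp; omega) =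
        (I.edges.map fun e => s(e.1, e.2))[i]'(by rw [List.length_map]; exact hi) := by
      rw [List.getElem_map, List.getElem_map]
      rwa [List.getElem_take] at h
    exact hji.ne ((I.nodup.getElem_inj_iff).1 h')
  rintro (h | h)
  · exact key _ h rfl
  · exact key _ h Sym2.eq_swap

/-- Each inner vertex, that is, each vertex with label `0`, has at most two inner neighbours. -/
def DegreeLeTwo (I : LabelledEdgeList) : Prop :=
  ∀ y, I.label y = 0 → ∀ z₁ z₂ z₃, I.label z₁ = 0 → I.label z₂ = 0 → I.label z₃ = 0 →
    I.graph.Adj y z₁ → I.graph.Adj y z₂ → I.graph.Adj y z₃ → z₁ = z₂ ∨ z₁ = z₃ ∨ z₂ = z₃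

/-- The state after the first `i` edges have been recorded. -/
structure Recording (I : LabelledEdgeList) (k i : ℕ) (σ : State) : Prop where
  reg_zero : σ.reg 0 = I.n
  reg_one : σ.reg 1 = I.m
  reg_two : σ.reg 2 = i
  reg_three : σ.reg 3 = 0
  le : i ≤ I.m
  reg_nine : σ.reg 9 = 0
  arr : ∀ c, (c < 3 ∨ 6 ≤ c) → σ.arr c = I.init.arr c
  recorded : Recorded k I.label (I.pairs i) σ.arr

theorem recording_init : I.Recording k 0 I.init := by
  refine ⟨rfl, rfl, rfl, rfl, by omega, rfl, fun _ _ => rfl, ?_⟩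
  have : I.pairs 0 = ∅ := by ext; simp [pairs]
  rw [this]
  refine .empty fun a ha i => ?_
  obtain ⟨a, rfl⟩ := Nat.exists_eq_add_of_le' ha
  rfl

theorem Recording.recordEdge {i : ℕ} {σ : State} (h : I.Recording k i σ) (hi : i < I.m)
    (hdeg : I.DegreeLeTwo) (hlab : ∀ x, I.label x ≤ k) :
    I.Recording k (i + 1) ((Program.recordEdge k).exec σ) := by
  set x := (I.edges[i]'hi).1 with hx
  set y := (I.edges[i]'hi).2 with hy
  have hxy : (x, y) = I.edges[i]'hi := rfl
  have hne : x ≠ y := I.loopless _ (List.getElem_mem hi)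
  have hadj : I.graph.Adj x y := .inl (List.getElem_mem hi)
  have h1 : σ.arr 1 i = x := by
    rw [h.arr 1 (by omega)]
    simp [init, hi, hx]
  have h2 : σ.arr 2 i = y := by
    rw [h.arr 2 (by omega)]
    simp [init, hi, hy]
  have h0 (z : Fin I.n) : σ.arr 0 z = I.label z := by
    rw [h.arr 0 (by omega)]
    simp [init]
  have hxyD : (x, y) ∉ I.pairs i := getElem_notMem_pairs hi
  have hyxD : (y, x) ∉ I.pairs i := fun h => hxyD h.symm
  set σ₁ := (((((σ.setReg 7 x).setReg 8 y).setReg 5 (I.label x)).setReg 6 (I.label y)).setReg 7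
    (x + 1)).setReg 8 (y + 1) with hσ₁
  obtain ⟨hr₂, hreg₂, harr₂⟩ := Recorded.halfEdge (σ := σ₁) (x := x) (y := y) (a := 7) (la := 5)
    (b := 8) (lb := 6) h.recorded (hlab x) hxyD
    (fun hx0 hy0 z₁ z₂ hz₁ hz₂ hzy₁ hzy₂ => by
      obtain h | rfl | rfl := hdeg y hy0 z₁ z₂ x hz₁ hz₂ hx0 (adj_of_mem_pairs hzy₁).symm
        (adj_of_mem_pairs hzy₂).symm hadj.symm
      exacts [h, absurd hzy₁ hxyD, absurd hzy₂ hxyD])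
    (by simp [hσ₁]) (by simp [hσ₁]) (by simp [hσ₁]) (by simp [hσ₁]) (by simp [hσ₁, h.reg_nine])
    (by omega) (by omega) (by omega)
  set σ₂ := (Program.halfEdge k 7 5 8 6).exec σ₁ with hσ₂
  have hyxD' : (y, x) ∉ insert (x, y) (I.pairs i) := by
    rintro (h | h)
    · exact hne (Prod.mk.inj h).2
    · exact hyxD h
  have hreg₂' (r) (hr : r < 10) : σ₂.reg r = σ₁.reg r := hreg₂ r hr
  obtain ⟨hr₃, hreg₃, harr₃⟩ := Recorded.halfEdge (σ := σ₂) (x := y) (y := x) (a := 8) (la := 6)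
    (b := 7) (lb := 5) hr₂ (hlab y) hyxD'
    (fun hy0 hx0 z₁ z₂ hz₁ hz₂ hzx₁ hzx₂ => by
      have key (z) (hz : (z, x) ∈ insert (x, y) (I.pairs i)) : (z, x) ∈ I.pairs i :=
        hz.resolve_left fun h => hne (Prod.mk.inj h).2
      have hzx₁ := key _ hzx₁
      have hzx₂ := key _ hzx₂
      obtain h | rfl | rfl := hdeg x hx0 z₁ z₂ y hz₁ hz₂ hy0 (adj_of_mem_pairs hzx₁).symm
        (adj_of_mem_pairs hzx₂).symm hadj
      exacts [h, absurd hzx₁ hyxD, absurd hzx₂ hyxD])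
    (by simp [hreg₂', hσ₁]) (by simp [hreg₂', hσ₁]) (by simp [hreg₂', hσ₁])
    (by simp [hreg₂', hσ₁]) (by simp [hreg₂', hσ₁, h.reg_nine]) (by omega) (by omega) (by omega)
  set σ₃ := (Program.halfEdge k 8 6 7 5).exec σ₂ with hσ₃
  have hexec : (Program.recordEdge k).exec σ = σ₃.setReg 2 (i + 1) := by
    have hσ₃2 : σ₃.reg 2 = i := by
      rw [hreg₃ 2 (by omega), hreg₂' 2 (by omega)]
      simp [hσ₁, h.reg_two]
    simp only [Program.recordEdge, Program.exec]
    simp only [State.reg_setReg, State.arr_setReg, h.reg_two, h1, h2, h0,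
      reduceIte, Nat.reduceEqDiff]
    rw [← hσ₁, ← hσ₂, ← hσ₃, hσ₃2]
  rw [hexec]
  refine ⟨?_, ?_, ?_, ?_, hi, ?_, fun c hc => ?_, ?_⟩
  · simpa [hreg₃, hreg₂', hσ₁] using h.reg_zero
  · simpa [hreg₃, hreg₂', hσ₁] using h.reg_one
  · simp
  · simpa [hreg₃, hreg₂', hσ₁] using h.reg_three
  · simpa [hreg₃, hreg₂', hσ₁] using h.reg_nine
  · rw [State.arr_setReg, harr₃ c hc, harr₂ c hc]
    exact h.arr c hc
  · rw [pairs_succ hi]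
    exact hr₃

/-- The first loop of the program records all edges. -/
theorem exists_runs_recordEdge (hdeg : I.DegreeLeTwo) (hlab : ∀ x, I.label x ≤ k) :
    ∃ t τ, Runs (.loop (.lt 2 1) (Program.recordEdge k)) I.init t τ ∧
      t ≤ ((Program.recordEdge k).cost + 1) * I.m + 1 ∧ I.Recording k I.m τ := by
  obtain ⟨t, τ, hrun, ht, hb, f, i, -, h⟩ := Program.exists_runs_loop
    (Program.loopFree_recordEdge k) (b := .lt 2 1)
    (Inv := fun f σ => ∃ i, f + i = I.m ∧ I.Recording k i σ) (by
      rintro f σ ⟨i, hf, h⟩ hb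
      have hi : i < I.m := by simpa [Test.Holds, h.reg_one, h.reg_two] using hb
      exact ⟨f - 1, by omega, i + 1, by omega, h.recordEdge hi hdeg hlab⟩)
    I.m I.init ⟨0, by omega, recording_init⟩
  refine ⟨t, τ, hrun, ht, ?_⟩
  have hi : ¬ i < I.m := by simpa [Test.Holds, h.reg_one, h.reg_two] using hb
  obtain rfl : i = I.m := le_antisymm h.le (not_lt.1 hi)
  exact h

end LabelledEdgeList

/-! ### Running the automaton along the paths -/

namespace LabelledEdgeList

open RAM

variable {I : LabelledEdgeList} {k s : ℕ}

/-- The transition table of an automaton, for letters that tell whether the vertex is adjacent to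
the previous one by `b`, and the neighbours of the vertex in the base by the binary digits of `c`.
Numbers that are not states are sent to the junk value `0`. -/
noncomputable def table (step : (Fin k → Prop) → Prop → Unit → Fin s → Fin s) (b : Prop)
    (q c : ℕ) : ℕ :=
  if h : q < s then step (fun j => c.testBit j = true) b () ⟨q, h⟩ else 0

/-- The state in which vertex `v` is the next one to be considered as a start, and the inner
vertices in `L` have been traversed; they are listed from the last to the first. -/
structure Traversing (I : LabelledEdgeList) (k : ℕ) (base : Fin k → Fin I.n)
    (step : (Fin k → Prop) → Prop → Unit → Fin s → Fin s) (q₀ : Fin s) (v : ℕ) (L : List (Fin I.n))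
    (σ : State) : Prop where
  reg_zero : σ.reg 0 = I.n
  reg_two : σ.reg 2 = v
  reg_four : σ.reg 4 = scan I.graph base (fun _ => ()) step q₀ L
  reg_nine : σ.reg 9 = 0
  arr_zero : σ.arr 0 = I.init.arr 0
  recorded : Recorded k I.label (I.pairs I.m) σ.arr
  visited : ∀ y : Fin I.n, σ.arr 6 (y + 1) = 0 ↔ y ∉ L
  visited_zero : σ.arr 6 0 ≠ 0

variable {base : Fin k → Fin I.n} {step : (Fin k → Prop) → Prop → Unit → Fin s → Fin s} {q₀ : Fin s}
  {v : ℕ} {L : List (Fin I.n)} {σ : State}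

theorem Traversing.congr {τ : State} {v' : ℕ} (h : Traversing I k base step q₀ v L σ)
    (h0 : τ.reg 0 = σ.reg 0) (h2 : τ.reg 2 = v') (h4 : τ.reg 4 = σ.reg 4)
    (h9 : τ.reg 9 = σ.reg 9) (harr : τ.arr = σ.arr) : Traversing I k base step q₀ v' L τ where
  reg_zero := h0.trans h.reg_zero
  reg_two := h2
  reg_four := h4.trans h.reg_four
  reg_nine := h9.trans h.reg_nine
  arr_zero := harr ▸ h.arr_zero
  recorded := harr ▸ h.recorded
  visited := harr ▸ h.visited
  visited_zero := harr ▸ h.visited_zero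

theorem Traversing.visit (h : Traversing I k base step q₀ v L σ) {y : Fin I.n} {b : Prop}
    (hbase : ∀ x j, I.label x = j.val + 1 ↔ x = base j) (hy : I.label y = 0)
    (h7 : σ.reg 7 = y + 1) (hb : (∃ z ∈ L.head?, I.graph.Adj y z) ↔ b) :
    Traversing I k base step q₀ v (y :: L) ((Program.visit k s (table step b)).exec σ) ∧
      ((Program.visit k s (table step b)).exec σ).reg 3 = y + 1 := by
  have hc := h.recorded.code_lt y hy
  set c := σ.arr 5 (y + 1) with hcdef
  set q := scan I.graph base (fun _ => ()) step q₀ L with hq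
  have hcode : (fun j : Fin k => c.testBit j = true) = fun j => I.graph.Adj (base j) y := by
    funext j
    rw [hcdef, h.recorded.code y hy]
    simp [hbase, mem_pairs_m]
  rw [Program.exec_visit (by rw [h.reg_four]; exact Fin.is_lt _) (by rwa [h7]), h7, ← hcdef,
    h.reg_four, ← hq]
  refine ⟨⟨?_, ?_, ?_, ?_, ?_, ?_, fun z => ?_, ?_⟩, by simp⟩
  · simpa using h.reg_zero
  · simpa using h.reg_two
  · simp only [State.reg_setReg, State.reg_setArr, Nat.reduceEqDiff, reduceIte, scan, ← hq]
    rw [table, dif_pos q.2, hcode, propext hb]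
  · simpa using h.reg_nine
  · simpa using h.arr_zero
  · obtain ⟨h₁, h₂, h₃, h₄, h₅, h₆⟩ := h.recorded
    constructor <;> simpa
  · by_cases hzy : z = y
    · simp [hzy]
    · have : (z : ℕ) + 1 ≠ y + 1 := fun h => hzy (Fin.ext (by omega))
      simp [Function.update_of_ne this, h.visited, hzy]
  · simpa using h.visited_zero

/-- A vertex with no second recorded inner neighbour has at most one inner neighbour. -/
theorem eq_of_adj_of_arr_eq_zero {arr : ℕ → ℕ → ℕ} (h : Recorded k I.label (I.pairs I.m) arr)
    {y : Fin I.n} (hy : I.label y = 0) (h4 : arr 4 (y + 1) = 0) (z z' : Fin I.n)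
    (hz : I.label z = 0) (hz' : I.label z' = 0) (hyz : I.graph.Adj y z) (hyz' : I.graph.Adj y z') :
    z = z' := by
  have h₁ := h.complete z y hz hy (mem_pairs_m.2 hyz.symm)
  have h₂ := h.complete z' y hz' hy (mem_pairs_m.2 hyz'.symm)
  exact Fin.ext (by omega)

/-- The invariant of the second loop. The fuel `f` is `2 * (n - v) + 3 * (n - L.length)`, plus `1`
if there is a current vertex, written without subtraction; so it decreases when `v` is increased,
when a vertex is traversed, and when the current vertex is dropped. -/
def TraverseInv (I : LabelledEdgeList) (k : ℕ) (base : Fin k → Fin I.n)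
    (step : (Fin k → Prop) → Prop → Unit → Fin s → Fin s) (q₀ : Fin s) (f : ℕ) (σ : State) : Prop :=
  ∃ v L, Traversing I k base step q₀ v L σ ∧ v ≤ I.n ∧
    (∀ y : Fin I.n, y.val < v → I.label y = 0 → σ.arr 4 (y + 1) = 0 → y ∈ L) ∧
    ((σ.reg 3 = 0 ∧ ClosedTrail I.graph (I.label · = 0) L ∧ f + 2 * v + 3 * L.length = 5 * I.n) ∨
      ∃ x L', L = x :: L' ∧ v < I.n ∧ σ.reg 3 = x + 1 ∧ OpenTrail I.graph (I.label · = 0) x L' ∧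
        f + 2 * v + 3 * L.length = 5 * I.n + 1)

theorem length_le_of_nodup (h : L.Nodup) : L.length ≤ I.n := by
  simpa using h.length_le_card

theorem arr_four_visit {δ : ℕ → ℕ → ℕ} (h : Traversing I k base step q₀ v L σ) {y : Fin I.n}
    (hy : I.label y = 0) (h7 : σ.reg 7 = y + 1) :
    ((Program.visit k s δ).exec σ).arr 4 = σ.arr 4 := by
  rw [Program.exec_visit (by rw [h.reg_four]; exact Fin.is_lt _)
    (by rw [h7]; exact h.recorded.code_lt y hy)]
  simp

theorem TraverseInv.traverse {f : ℕ} (h : TraverseInv I k base step q₀ f σ)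
    (hb : (Test.lt 2 0).Holds σ) (hdeg : I.DegreeLeTwo)
    (hbase : ∀ x j, I.label x = j.val + 1 ↔ x = base j) :
    ∃ f' < f, TraverseInv I k base step q₀ f'
      ((Program.traverse k s (table step False) (table step True)).exec σ) := by
  obtain ⟨v, L, hT, hv, hstart, ⟨h3, hL, hf⟩ | ⟨x, L', rfl, hvn, h3, hL, hf⟩⟩ := h
  · have hvn : v < I.n := by simpa [Test.Holds, hT.reg_zero, hT.reg_two] using hb
    set y : Fin I.n := ⟨v, hvn⟩ with hy
    have hlab : σ.arr 0 v = I.label y := by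
      rw [hT.arr_zero]
      simp [init, hvn, hy]
    set τ := ((((σ.setReg 5 (I.label y)).setReg 7 v).setReg 7 (v + 1)).setReg 6
      (σ.arr 6 (v + 1))).setReg 8 (σ.arr 4 (v + 1)) with hτ
    have hTτ : Traversing I k base step q₀ v L τ :=
      hT.congr (by simp [hτ]) (by simpa [hτ] using hT.reg_two) (by simp [hτ]) (by simp [hτ]) rfl
    have hexec : (Program.traverse k s (table step False) (table step True)).exec σ =
        if I.label y = 0 ∧ σ.arr 6 (v + 1) = 0 ∧ σ.arr 4 (v + 1) = 0 then
          (Program.visit k s (table step False)).exec τ else τ.setReg 2 (v + 1) := by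
      rw [Program.traverse, Program.exec, if_pos (by simp [Test.Holds, h3, hT.reg_nine])]
      simp only [Program.exec, State.reg_setReg, State.arr_setReg, hT.reg_two, hlab, Test.Holds,
        reduceIte, Nat.reduceEqDiff, ← hτ]
      have hτ2 : τ.reg 2 = v := hTτ.reg_two
      have hτ5 : τ.reg 5 = I.label y := by simp [hτ]
      have hτ6 : τ.reg 6 = σ.arr 6 (v + 1) := by simp [hτ]
      have hτ8 : τ.reg 8 = σ.arr 4 (v + 1) := by simp [hτ]
      rw [hτ2, hτ5, hτ6, hτ8, hTτ.reg_nine]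
      split_ifs <;> first | rfl | (exfalso; tauto)
    rw [hexec]
    split_ifs with hcond
    · obtain ⟨hy0, hy6, hy4⟩ := hcond
      have hyL : y ∉ L := (hT.visited y).1 hy6
      have hopen := hL.cons hy0 hyL (eq_of_adj_of_arr_eq_zero hT.recorded hy0 hy4)
      have hlen := length_le_of_nodup hopen.nodup
      rw [List.length_cons] at hlen
      obtain ⟨hT', h3'⟩ := hTτ.visit (y := y) (b := False) hbase hy0 (by simp [hτ, hy]) (by
        simp only [iff_false, not_exists, not_and]
        exact fun z hz => hL.not_adj hy0 hyL z (List.mem_of_mem_head? hz))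
      refine ⟨f - 2, by omega, v, y :: L, hT', hv, fun z hz hz0 hz4 => ?_,
        .inr ⟨y, L, rfl, hvn, h3', hopen, ?_⟩⟩
      · rw [arr_four_visit hTτ hy0 (by simp [hτ, hy])] at hz4
        exact List.mem_cons_of_mem _ (hstart z hz hz0 hz4)
      · rw [List.length_cons]
        omega
    · have hlen := length_le_of_nodup hL.nodup
      refine ⟨f - 2, by omega, v + 1, L, hTτ.congr (by simp) (by simp) (by simp) (by simp) rfl, hvn,
        fun z hz hz0 hz4 => ?_, .inl ⟨by simpa [hτ] using h3, hL, by omega⟩⟩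
      obtain hz | hz := (Nat.lt_succ_iff.1 hz).lt_or_eq
      · exact hstart z hz hz0 hz4
      · obtain rfl : z = y := Fin.ext hz
        by_contra hzL
        exact hcond ⟨hz0, (hT.visited _).2 hzL, hz4⟩
  · have hx0 : I.label x = 0 := hL.inner x (by simp)
    have hlen := length_le_of_nodup hL.nodup
    -- both neighbours are treated in the same way
    have key (τ : State) (hTτ : Traversing I k base step q₀ v (x :: L') τ) (h4 : τ.arr 4 = σ.arr 4)
        (h7 : τ.reg 7 ≠ 0 → ∃ y : Fin I.n, τ.reg 7 = y + 1 ∧ I.graph.Adj x y ∧ I.label y = 0)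
        (h6 : τ.arr 6 (τ.reg 7) = 0) : ∃ f' < f, TraverseInv I k base step q₀ f'
          ((Program.visit k s (table step True)).exec τ) := by
      obtain ⟨y, h7, hxy, hy0⟩ := h7 fun h7 => hTτ.visited_zero (h7 ▸ h6)
      have hyL : y ∉ x :: L' := (hTτ.visited y).1 (h7 ▸ h6)
      have hopen := hL.cons hy0 hyL hxy (hdeg x hx0)
      have hlen := length_le_of_nodup hopen.nodup
      rw [List.length_cons] at hlen
      obtain ⟨hT', h3'⟩ := hTτ.visit (y := y) (b := True) hbase hy0 h7
        (by simpa using hxy.symm)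
      refine ⟨f - 3, by omega, v, y :: x :: L', hT', hv, fun z hz hz0 hz4 => ?_,
        .inr ⟨y, _, rfl, hvn, h3', hopen, ?_⟩⟩
      · rw [arr_four_visit hTτ hy0 h7, h4] at hz4
        exact List.mem_cons_of_mem _ (hstart z hz hz0 hz4)
      · rw [List.length_cons]
        omega
    set y₁ := σ.arr 3 (x + 1) with hy₁
    set y₂ := σ.arr 4 (x + 1) with hy₂
    set τ₁ := (σ.setReg 7 y₁).setReg 6 (σ.arr 6 y₁) with hτ₁
    set τ₂ := (τ₁.setReg 7 y₂).setReg 6 (σ.arr 6 y₂) with hτ₂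
    have hTτ₁ : Traversing I k base step q₀ v (x :: L') τ₁ :=
      hT.congr (by simp [hτ₁]) (by simpa [hτ₁] using hT.reg_two) (by simp [hτ₁]) (by simp [hτ₁]) rfl
    have hTτ₂ : Traversing I k base step q₀ v (x :: L') τ₂ :=
      hT.congr (by simp [hτ₁, hτ₂]) (by simpa [hτ₁, hτ₂] using hT.reg_two) (by simp [hτ₁, hτ₂])
        (by simp [hτ₁, hτ₂]) rfl
    have hexec : (Program.traverse k s (table step False) (table step True)).exec σ =
        if σ.arr 6 y₁ = 0 then (Program.visit k s (table step True)).exec τ₁ else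
          if σ.arr 6 y₂ = 0 then (Program.visit k s (table step True)).exec τ₂ else
            τ₂.setReg 3 0 := by
      rw [Program.traverse, Program.exec, if_neg (by simp [Test.Holds, h3, hT.reg_nine])]
      simp only [Program.exec, State.reg_setReg, State.arr_setReg, Test.Holds,
        h3, reduceIte, Nat.reduceEqDiff, ← hy₁, ← hτ₁]
      have hτ₁3 : τ₁.reg 3 = x + 1 := by simpa [hτ₁] using h3
      have hτ₁4 : τ₁.arr 4 (x + 1) = y₂ := rfl
      have hτ₁6 : τ₁.arr 6 y₂ = σ.arr 6 y₂ := rfl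
      have hτ₁6' : τ₁.reg 6 = σ.arr 6 y₁ := by simp [hτ₁]
      rw [hτ₁3, hτ₁4, hτ₁6, hTτ₁.reg_nine, ← hτ₂, hτ₁6']
    rw [hexec]
    split_ifs with h₁ h₂
    · refine key τ₁ hTτ₁ rfl (fun h => ?_) (by simpa [hτ₁] using h₁)
      obtain ⟨y, hy, hyx, hy0⟩ := hT.recorded.sound_fst x hx0 (by simpa [hτ₁] using h)
      exact ⟨y, by simpa [hτ₁] using hy, (mem_pairs_m.1 hyx).symm, hy0⟩
    · refine key τ₂ hTτ₂ rfl (fun h => ?_) (by simpa [hτ₂, hτ₁] using h₂)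
      obtain ⟨y, hy, hyx, hy0⟩ := hT.recorded.sound_snd x hx0 (by simpa [hτ₂] using h)
      exact ⟨y, by simpa [hτ₂] using hy, (mem_pairs_m.1 hyx).symm, hy0⟩
    · refine ⟨f - 1, by omega, v, x :: L', hTτ₂.congr (by simp) (by simpa using hTτ₂.reg_two)
        (by simp) (by simp) rfl, hv, hstart,
        .inl ⟨by simp, hL.closedTrail fun z hz hxz => ?_, by omega⟩⟩
      by_contra hzL
      have hz6 := (hT.visited z).2 hzL
      obtain h | h := hT.recorded.complete z x hz hx0 (mem_pairs_m.2 hxz.symm)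
      · exact h₁ (by rwa [hy₁, h])
      · exact h₂ (by rwa [hy₂, h])

/-- A set of inner vertices contains all of them if it is closed under adjacency and contains all
those with at most one inner neighbour. This says that no component is a cycle. -/
def NoCycle (I : LabelledEdgeList) : Prop :=
  ∀ S : Set (Fin I.n), (∀ y ∈ S, ∀ z, I.label z = 0 → I.graph.Adj y z → z ∈ S) →
    (∀ y, I.label y = 0 → (∀ z z', I.label z = 0 → I.label z' = 0 → I.graph.Adj y z →
      I.graph.Adj y z' → z = z') → y ∈ S) → ∀ y, I.label y = 0 → y ∈ S

/-- The program computes the final state of the automaton along some layout of the graph. -/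
theorem exists_runs_decider (hdeg : I.DegreeLeTwo) (hcyc : I.NoCycle) (hlab : ∀ x, I.label x ≤ k)
    (hinj : Function.Injective base) (hbase : ∀ x j, I.label x = j.val + 1 ↔ x = base j)
    {E : SimpleGraph (Fin k)} (hE : ∀ i j, I.graph.Adj (base i) (base j) ↔ E.Adj i j)
    (ans : ℕ → ℕ) :
    ∃ t τ L, Runs (Program.decider k s (table step False) (table step True) q₀ ans) I.init t τ ∧
      t ≤ Program.slope k s (table step False) (table step True) ans * (I.n + I.m + 1) ∧
      IsLayout E I.graph base L ∧
      τ.reg 0 = ans (scan I.graph base (fun _ => ()) step q₀ L).val := by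
  obtain ⟨t₁, σ₁, hrun₁, ht₁, h₁⟩ := exists_runs_recordEdge hdeg hlab
  set σ₂ := (((σ₁.setReg 2 0).setReg 4 q₀).setReg 11 1).setArr 6 0 1 with hσ₂
  have hrun₂ : Runs (.seq (.const 2 0) <| .seq (.const 4 q₀) <| .seq (.const 11 1) (.store 6 9 11))
      σ₁ 4 σ₂ := by
    have := (Runs.const σ₁ 2 0).seq <| (Runs.const _ 4 q₀).seq <| (Runs.const _ 11 1).seq <|
      Runs.store _ 6 9 11
    simpa [h₁.reg_nine, hσ₂] using this
  have hinv : TraverseInv I k base step q₀ (5 * I.n) σ₂ := by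
    refine ⟨0, [], ⟨?_, ?_, ?_, ?_, ?_, ?_, fun y => ?_, ?_⟩, by omega, by simp,
      .inl ⟨?_, .nil, by simp⟩⟩
    · simpa [hσ₂] using h₁.reg_zero
    · simp [hσ₂]
    · simp [hσ₂, scan]
    · simpa [hσ₂] using h₁.reg_nine
    · simpa [hσ₂] using h₁.arr 0 (by omega)
    · obtain ⟨h₁, h₂, h₃, h₄, h₅, h₆⟩ := h₁.recorded
      constructor <;> simpa [hσ₂]
    · simp [hσ₂, h₁.arr 6 (by omega), init]
    · simp [hσ₂]
    · simpa [hσ₂] using h₁.reg_three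
  obtain ⟨t₃, σ₃, hrun₃, ht₃, hb, f, v, L, hT, hv, hstart, hend⟩ := Program.exists_runs_loop
    (Program.loopFree_traverse k s (table step False) (table step True)) (b := .lt 2 0)
    (Inv := TraverseInv I k base step q₀) (fun f σ h hb => h.traverse hb hdeg hbase) _ _ hinv
  have hvn : ¬ v < I.n := by simpa [Test.Holds, hT.reg_zero, hT.reg_two] using hb
  obtain ⟨-, hL, -⟩ | ⟨-, -, -, hvn', -⟩ := hend
  swap
  · exact absurd hvn' hvn
  have hall : ∀ y, I.label y = 0 → y ∈ L := by
    refine hcyc {y | y ∈ L} hL.closed fun y hy hyz => hstart y (by omega) hy ?_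
    by_contra h4
    obtain ⟨z, hz, hzy, hz0⟩ := hT.recorded.sound_snd y hy h4
    obtain ⟨z', hz', hzy', hz0'⟩ := hT.recorded.sound_fst y hy (hT.recorded.ne y hy h4).1
    apply (hT.recorded.ne y hy h4).2
    rw [hz, hz', hyz z z' hz0 hz0' (mem_pairs_m.1 hzy).symm (mem_pairs_m.1 hzy').symm]
  have hlayout : IsLayout E I.graph base L := by
    refine ⟨hinj, hL.nodup, fun j hj => ?_, fun x => ?_, hE, hL.linear⟩
    · have h₁ := hL.inner _ hj
      have h₂ := (hbase (base j) j).2 rfl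
      omega
    · by_cases hx : I.label x = 0
      · exact .inr (hall x hx)
      · have := hlab x
        exact .inl ⟨⟨I.label x - 1, by omega⟩, ((hbase x _).1 (by simp; omega)).symm⟩
  obtain ⟨t₄, ht₄, hrun₄⟩ := Program.exists_runs_exec (P := Program.switch 4 12 s fun q =>
    .const 0 (ans q)) (Program.loopFree_switch fun _ => trivial) σ₃
  refine ⟨_, _, L, hrun₁.seq (hrun₂.seq (hrun₃.seq hrun₄)), ?_, hlayout, ?_⟩
  · rw [Program.slope]
    set a := (Program.recordEdge k).cost
    set b := (Program.traverse k s (table step False) (table step True)).cost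
    set d := (Program.switch 4 12 s fun q => .const 0 (ans q)).cost
    calc t₁ + (4 + (t₃ + t₄))
        ≤ ((a + 1) * I.m + 1) + (4 + (((b + 1) * (5 * I.n) + 1) + d)) := by omega
      _ ≤ (a + 5 * b + d + 12) * (I.n + I.m + 1) := by
        nlinarith [Nat.zero_le (a * I.n), Nat.zero_le (b * I.m), Nat.zero_le (d * I.n),
          Nat.zero_le (d * I.m)]
  · rw [Program.exec_switch (by omega) (by rw [hT.reg_four]; exact Fin.is_lt _)]
    simp [Program.exec, hT.reg_four]

end LabelledEdgeList

/-! ### Realizations of pathographs without rungs -/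

namespace LabelledEdgeList.Compatible

variable {I : LabelledEdgeList} {H : Pathograph.{u}} {k : ℕ} {num : H.V ≃ Fin k}
  {ρ : H.Realization I.graph}

theorem label_eq_succ_iff (h : I.Compatible num ρ) (x : Fin I.n) (j : Fin k) :
    I.label x = j + 1 ↔ x = ρ.vert (num.symm j) := by
  constructor
  · intro hx
    by_cases hr : x ∈ Set.range ρ.vert
    · obtain ⟨a, rfl⟩ := hr
      rw [h.1] at hx
      rw [← (Fin.ext (by omega) : num a = j), num.symm_apply_apply]
    · rw [h.2 x hr] at hx
      omega
  · rintro rfl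
    rw [h.1, num.apply_symm_apply]

theorem label_le (h : I.Compatible num ρ) (x : Fin I.n) : I.label x ≤ k := by
  by_cases hr : x ∈ Set.range ρ.vert
  · obtain ⟨a, rfl⟩ := hr
    rw [h.1]
    exact (num a).2
  · simp [h.2 x hr]

theorem label_eq_zero_iff (h : I.Compatible num ρ) (x : Fin I.n) :
    I.label x = 0 ↔ ∃ p i, ρ.inner p i = x := by
  constructor
  · intro hx
    obtain ⟨a | ⟨p, i⟩, rfl⟩ := ρ.bijective.2 x
    · rw [Sum.elim_inl, h.1] at hx
      omega
    · exact ⟨p, i, rfl⟩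
  · rintro ⟨p, i, rfl⟩
    refine h.2 _ ?_
    rintro ⟨a, ha⟩
    have := ρ.bijective.1 (a₁ := .inl a) (a₂ := .inr ⟨p, i⟩) ha
    simp at this

theorem exists_eq_inner (h : I.Compatible num ρ) (hH : H.Rungless) {p : H.U} {i : Fin (ρ.len p)}
    {z : Fin I.n} (hz : I.label z = 0) (hadj : I.graph.Adj (ρ.inner p i) z) :
    ∃ j, ρ.inner p j = z ∧ (i.val + 1 = j.val ∨ j.val + 1 = i.val) := by
  obtain ⟨q, j, rfl⟩ := (h.label_eq_zero_iff z).1 hz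
  obtain rfl : p = q := by
    by_contra hpq
    exact hH p q ((ρ.adj_rung p q hpq).2 ⟨i, j, hadj⟩)
  exact ⟨j, rfl, (ρ.adj_inner p i j).1 hadj⟩

theorem degreeLeTwo (h : I.Compatible num ρ) (hH : H.Rungless) : I.DegreeLeTwo := by
  intro y hy z₁ z₂ z₃ hz₁ hz₂ hz₃ hyz₁ hyz₂ hyz₃
  obtain ⟨p, i, rfl⟩ := (h.label_eq_zero_iff y).1 hy
  obtain ⟨j₁, rfl, h₁⟩ := h.exists_eq_inner hH hz₁ hyz₁
  obtain ⟨j₂, rfl, h₂⟩ := h.exists_eq_inner hH hz₂ hyz₂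
  obtain ⟨j₃, rfl, h₃⟩ := h.exists_eq_inner hH hz₃ hyz₃
  have : j₁ = j₂ ∨ j₁ = j₃ ∨ j₂ = j₃ := by
    simp only [Fin.ext_iff]
    omega
  exact this.imp (congrArg _) (Or.imp (congrArg _) (congrArg _))

theorem noCycle (h : I.Compatible num ρ) (hH : H.Rungless) : I.NoCycle := by
  intro S hS hends y hy
  obtain ⟨p, ⟨i, hi⟩, rfl⟩ := (h.label_eq_zero_iff y).1 hy
  clear hy
  induction i with
  | zero =>
    refine hends _ ((h.label_eq_zero_iff _).2 ⟨p, _, rfl⟩) fun z z' hz hz' hyz hyz' => ?_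
    obtain ⟨j, rfl, hj⟩ := h.exists_eq_inner hH hz hyz
    obtain ⟨j', rfl, hj'⟩ := h.exists_eq_inner hH hz' hyz'
    simp only at hj hj'
    exact congrArg _ (Fin.ext (by omega))
  | succ i ih =>
    exact hS _ (ih (by omega)) _ ((h.label_eq_zero_iff _).2 ⟨p, _, rfl⟩)
      ((ρ.adj_inner p _ _).2 (.inl rfl))

end LabelledEdgeList.Compatible

/-- The program and the constant depend on `H`, the numbering of its vertices, and `𝓕` only. The
answer is left in register `0`: `1` for `𝓕`-free, `0` for not `𝓕`-free. -/
theorem theorem4 (H : Pathograph.{u}) (hH : H.Rungless) (𝓕 : Set Pathograph.{v}) (h𝓕 : 𝓕.Finite)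
    (k : ℕ) (num : H.V ≃ Fin k) :
    ∃ (P : RAM.Program) (c : ℕ), ∀ (I : LabelledEdgeList) (ρ : H.Realization I.graph),
      I.Compatible num ρ →
        ∃ (t : ℕ) (τ : RAM.State), RAM.Runs P I.init t τ ∧ t ≤ c * (I.n + I.m + 1) ∧
          (Pathograph.IsFree 𝓕 I.graph → τ.reg 0 = 1) ∧
          (¬ Pathograph.IsFree 𝓕 I.graph → τ.reg 0 = 0) := by
  classical
  obtain ⟨s, step, q₀, acc, hacc⟩ := Definable.isFree (E := H.E.comap num.symm) h𝓕 fun _ => ()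
  set ans : ℕ → ℕ := fun q => if ∃ h : q < s, (⟨q, h⟩ : Fin s) ∈ acc then 1 else 0
  refine ⟨RAM.Program.decider k s (LabelledEdgeList.table step False)
    (LabelledEdgeList.table step True) q₀ ans,
    RAM.Program.slope k s (LabelledEdgeList.table step False) (LabelledEdgeList.table step True) ans,
    fun I ρ hρ => ?_⟩
  have hinj : Function.Injective fun j => ρ.vert (num.symm j) := fun i j hij => by
    have := ρ.bijective.1 (a₁ := .inl (num.symm i)) (a₂ := .inl (num.symm j)) hij
    simpa using this
  obtain ⟨t, τ, L, hrun, ht, hL, hτ⟩ := LabelledEdgeList.exists_runs_decider (step := step)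
    (q₀ := q₀) (E := H.E.comap num.symm) (hρ.degreeLeTwo hH) (hρ.noCycle hH) hρ.label_le hinj
    hρ.label_eq_succ_iff (fun i j => ρ.adj_vert _ _) ans
  have key := hacc (Fin I.n) I.graph _ L (fun _ => ()) hL fun _ => rfl
  refine ⟨t, τ, hrun, ht, fun h => ?_, fun h => ?_⟩
  · rw [hτ]
    exact if_pos ⟨Fin.is_lt _, key.1 h⟩
  · rw [hτ]
    exact if_neg fun ⟨_, h'⟩ => h (key.2 h')
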